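/- **Theorem 4.1.** Let $n\ge 4$, let $U\subset\mathbb R^2$ be open with coordinates $(x^1,x^2)$, let $C,D,p,q\in\mathbb R$ with $p\neq0$, $q\ne 0$, let $\mathfrak b=\mathfrak b(x^1)$ and $B=B(x^2)$ be smooth functions such that on $U$ $$\mathfrak b\ne0,\quad \mathfrak b'\neq 0,\quad D\mathfrak b-4C\ne0,\quad 1+q\mathfrak b\neq 0,\quad B\ne 0,\quad B''/B=C ,$$ and put $$\mathfrak a=\frac{(\mathfrak b')^2}{\mathfrak b(D\mathfrak b-4C)},\qquad \widehat g=\mathfrak a(x^1)(dx^1)^2+\mathfrak b(x^1)(dx^2)^2,\qquad F=\mathfrak b(x^1)B(x^2)^2,$$ $$\overline{\widehat g}=\frac{p\,\mathfrak a}{(1+q\mathfrak b)^2}(dx^1)^2+\frac{p\,\mathfrak b}{1+q\mathfrak b}(dx^2)^2,\qquad \overline F=\frac{p}{1+q\mathfrak b}F .$$ Let $(\widetilde N,\widetilde g)$ be an $(n-2)$-dimensional semi-Riemannian manifold, of constant curvature if $n\ge5$, with scalar curvature $\widetilde\kappa$. On $U\times\widetilde N$ consider the warped product metrics $g=\widehat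 g+F\,\widetilde g$ and $\overline g=\overline{\widehat g}+\overline F\,\widetilde g$ (the warping functions vanish nowhere; no sign is required). Suppose that the equality $$\frac{\widetilde\kappa}{(n-3)(n-2)}=(B')^2-CB^2\qquad(*)$$ does not hold identically on $U\times\widetilde N$. For a metric with Ricci tensor $S$, scalar curvature $\kappa$ and Weyl tensor $\mathcal C$, let $\mathcal U_S$ and $\mathcal U_{\mathcal C}$ be the sets of points where $S\neq\frac{\kappa}{n}g$ and where $\mathcal C\ne0$. A semi-Riemannian manifold of dimension $n\ge 4$ is *of Roter type* if on $\mathcal U_S\cap\mathcal U_{\mathcal C}$ its curvature tensor has the form $R=\frac{\phi}{2}S\wedge S+\mu\,g\wedge S+\frac{\eta}{2}g\wedge g$ with some functions $\phi,\mu,\eta$, where $\wedge$ is the Kulkarni-Nomizu product. A *geodesic mapping* is a diffeomorphism between semi-Riemannian manifolds that maps geodesics to geodesics up to parametrization, i.e. to curves with $\nabla_{\dot\gamma}\dot\gamma=\rho\dot\gamma$; it is *non-trivial* if the covector field $\psi=\frac{1}{2(n+1)}d\log\left|\frac{\det\overline g}{\det g}\right|$ (in common coordinates) vanishes nowhere.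 Then: 1. $(U\times\widetilde N,g)$ is a Roter type manifold, and its set $\mathcal U_S\cap\mathcal U_{\mathcal C}$ consists exactly of the points at which $(*)$ fails. 2. There is a geodesic mapping of $(U,\widehat g)$ onto $(U,\overline{\widehat g})$, and there is a non-trivial geodesic mapping of $(U\times\widetilde N,g)$ onto $(U\times\widetilde N,\overline g)$. 3. $(U\times\widetilde N,\overline g)$ is a Roter type manifold, and its set $\mathcal U_S\cap\mathcal U_{\mathcal C}$ consists exactly of the points at which $(*)$ fails. -/

import Mathlib

set_option maxSynthPendingDepth 3

open scoped Manifold ContDiff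
open Module

attribute [-instance] TopCat.of.chartedSpace

noncomputable section

namespace Roter

/-! ### Local differential geometry of a field of bilinear forms on a vector space

`G : E → E →L[ℝ] E →L[ℝ] ℝ` is a metric written in a coordinate domain of the model space `E`;
`G z u v` is the value at `z` on the (constant) coordinate vectors `u`, `v`. -/

section Local

variable {E : Type*} [NormedAddCommGroup E] [NormedSpace ℝ E]

/-- Christoffel symbols of the first kind:
`[u v, w] = (1/2) (∂_u G(v,w) + ∂_v G(u,w) - ∂_w G(u,v))`. -/
def christoffelLower (G : E → E →L[ℝ] E →L[ℝ] ℝ) (z : E) : E →L[ℝ] E →L[ℝ] E →L[ℝ] ℝ :=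
  let D : E →L[ℝ] E →L[ℝ] E →L[ℝ] ℝ := fderiv ℝ G z
  let D' : E →L[ℝ] E →L[ℝ] E →L[ℝ] ℝ :=
    (ContinuousLinearMap.flipₗᵢ ℝ E E ℝ).toContinuousLinearEquiv.toContinuousLinearMap ∘L D.flip
  (2⁻¹ : ℝ) • (D + D.flip - D')

lemma christoffelLower_apply (G : E → E →L[ℝ] E →L[ℝ] ℝ) (z u v w : E) :
    christoffelLower G z u v w =
      2⁻¹ * (fderiv ℝ G z u v w + fderiv ℝ G z v u w - fderiv ℝ G z w u v) := by
  simp [christoffelLower]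

/-- Christoffel symbols of the second kind `Γ(u,v)`: the first kind with the index raised by the
inverse of `G z`, where `G z` is read as the map `u ↦ G z u ·` from `E` to its dual. -/
def christoffel (G : E → E →L[ℝ] E →L[ℝ] ℝ) (z : E) : E →L[ℝ] E →L[ℝ] E :=
  (ContinuousLinearMap.compL ℝ E (E →L[ℝ] ℝ) E (G z).inverse) ∘L christoffelLower G z

lemma christoffel_apply (G : E → E →L[ℝ] E →L[ℝ] ℝ) (z u v : E) :
    christoffel G z u v = (G z).inverse (christoffelLower G z u v) := rfl

/-- The curvature operator, `curvature G z u v w = ℛ(u,v)w`. -/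
def curvature (G : E → E →L[ℝ] E →L[ℝ] ℝ) (z : E) : E →L[ℝ] E →L[ℝ] E →L[ℝ] E :=
  fderiv ℝ (christoffel G) z - (fderiv ℝ (christoffel G) z).flip +
    (ContinuousLinearMap.compL ℝ E E E).bilinearComp (christoffel G z) (christoffel G z) -
    ((ContinuousLinearMap.compL ℝ E E E).bilinearComp (christoffel G z) (christoffel G z)).flip

/-- `ℛ(u,v)w = ∇_u ∇_v w - ∇_v ∇_u w` for constant coordinate vector fields. -/
lemma curvature_apply (G : E → E →L[ℝ] E →L[ℝ] ℝ) (z u v w : E) :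
    curvature G z u v w =
      fderiv ℝ (christoffel G) z u v w - fderiv ℝ (christoffel G) z v u w +
        christoffel G z u (christoffel G z v w) - christoffel G z v (christoffel G z u w) := rfl

/-- The Ricci tensor `S(X,Y) = tr {Z ↦ ℛ(Z,X)Y}`. -/
def ricci (G : E → E →L[ℝ] E →L[ℝ] ℝ) (z : E) : E →ₗ[ℝ] E →ₗ[ℝ] ℝ :=
  LinearMap.mk₂ ℝ
    (fun X Y => LinearMap.trace ℝ E (((curvature G z).flip X).flip Y : E →L[ℝ] E).toLinearMap)
    (by intros; simp) (by intros; simp) (by intros; simp) (by intros; simp)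

lemma ricci_apply (G : E → E →L[ℝ] E →L[ℝ] ℝ) (z X Y : E) :
    ricci G z X Y =
      LinearMap.trace ℝ E
        { toFun := fun Z => curvature G z Z X Y
          map_add' := by intros; simp
          map_smul' := by intros; simp } := rfl

variable [FiniteDimensional ℝ E]

/-- The Ricci operator `𝒮`, `G(𝒮X, Y) = S(X,Y)`. -/
def ricciOp (G : E → E →L[ℝ] E →L[ℝ] ℝ) (z : E) : E →ₗ[ℝ] E :=
  (G z).inverse.toLinearMap ∘ₗ
    (LinearMap.toContinuousLinearMap : (E →ₗ[ℝ] ℝ) ≃ₗ[ℝ] (E →L[ℝ] ℝ)).toLinearMap ∘ₗ ricci G z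

/-- The scalar curvature `κ = tr 𝒮`. -/
def scalar (G : E → E →L[ℝ] E →L[ℝ] ℝ) (z : E) : ℝ :=
  LinearMap.trace ℝ E (ricciOp G z)

/-- The endomorphism `(X ∧_A Y) Z = A(Y,Z) X - A(X,Z) Y`. -/
def wedgeEnd (A : E → E → ℝ) (X Y Z : E) : E := A Y Z • X - A X Z • Y

/-- The Weyl conformal curvature operator `𝒞(X,Y)Z`, with `n = dim E`. -/
def weyl (G : E → E →L[ℝ] E →L[ℝ] ℝ) (z X Y Z : E) : E :=
  curvature G z X Y Z - (1 / ((finrank ℝ E : ℝ) - 2)) •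
    (wedgeEnd (fun u v => G z u v) X (ricciOp G z Y) Z +
      wedgeEnd (fun u v => G z u v) (ricciOp G z X) Y Z -
      (scalar G z / ((finrank ℝ E : ℝ) - 1)) • wedgeEnd (fun u v => G z u v) X Y Z)

/-- The Kulkarni-Nomizu product of two symmetric `(0,2)`-tensors. -/
def kulkarniNomizu (A B : E → E → ℝ) (X₁ X₂ X₃ X₄ : E) : ℝ :=
  A X₁ X₄ * B X₂ X₃ + A X₂ X₃ * B X₁ X₄ - A X₁ X₃ * B X₂ X₄ - A X₂ X₄ * B X₁ X₃

end Local

/-! ### Semi-Riemannian manifolds -/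

section Manifold

variable {E : Type*} [NormedAddCommGroup E] [NormedSpace ℝ E]
  {H : Type*} [TopologicalSpace H] (I : ModelWithCorners ℝ E H)
  (M : Type*) [TopologicalSpace M] [ChartedSpace H M]

/-- A field of bilinear forms on the tangent spaces of `M`. -/
abbrev FormField : Type _ :=
  (x : M) → TangentSpace I x →L[ℝ] TangentSpace I x →L[ℝ] ℝ

variable {I M}
  {E' : Type*} [NormedAddCommGroup E'] [NormedSpace ℝ E']
  {H' : Type*} [TopologicalSpace H'] {I' : ModelWithCorners ℝ E' H'}
  {M' : Type*} [TopologicalSpace M'] [ChartedSpace H' M']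

/-- The pullback `(f^* g)_x (u,v) = g_{f x} (df_x u, df_x v)`. -/
def pullback (I : ModelWithCorners ℝ E H) (f : M → M') (g : FormField I' M') : FormField I M :=
  fun x => (ContinuousLinearMap.precomp ℝ (mfderiv I I' f x)) ∘L (g (f x)) ∘L (mfderiv I I' f x)

lemma pullback_apply (f : M → M') (g : FormField I' M') (x : M) (u v : TangentSpace I x) :
    pullback I f g x u v = g (f x) (mfderiv I I' f x u) (mfderiv I I' f x v) := rfl

/-- The components of `g` in the preferred chart around `x₀`: the pullback of `g` under the inverse
of that chart. -/
def inChart (g : FormField I M) (x₀ : M) : E → E →L[ℝ] E →L[ℝ] ℝ :=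
  fun z => pullback 𝓘(ℝ, E) (extChartAt I x₀).symm g z

/-- `g` is a semi-Riemannian metric: symmetric, nondegenerate, with smooth components in charts. -/
structure IsSemiRiemannian (g : FormField I M) : Prop where
  symm : ∀ (x : M) (u v : TangentSpace I x), g x u v = g x v u
  nondegenerate : ∀ (x : M) (u : TangentSpace I x), (∀ v, g x u v = 0) → u = 0
  smooth : ∀ x₀ : M, ContDiffOn ℝ ∞ (inChart g x₀) (extChartAt I x₀).target

/-! Tensors at `x` are computed in the preferred chart around `x`, which is the chart through which
Mathlib identifies `TangentSpace I x` with `E`. -/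

section Tensors

/-- The metric at `x`, as a function on pairs of tangent vectors. -/
def metricAt (g : FormField I M) (x : M) (X Y : E) : ℝ :=
  inChart g x (extChartAt I x x) X Y

/-- The Riemann-Christoffel tensor `R(X₁,X₂,X₃,X₄) = g(ℛ(X₁,X₂)X₃, X₄)`. -/
def riemannAt (g : FormField I M) (x : M) (X₁ X₂ X₃ X₄ : E) : ℝ :=
  metricAt g x (curvature (inChart g x) (extChartAt I x x) X₁ X₂ X₃) X₄

/-- The Ricci tensor. -/
def ricciAt (g : FormField I M) (x : M) (X Y : E) : ℝ :=
  ricci (inChart g x) (extChartAt I x x) X Y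

variable [FiniteDimensional ℝ E]

/-- The scalar curvature. -/
def scalarAt (g : FormField I M) (x : M) : ℝ :=
  scalar (inChart g x) (extChartAt I x x)

/-- The Weyl conformal curvature tensor `C(X₁,X₂,X₃,X₄) = g(𝒞(X₁,X₂)X₃, X₄)`. -/
def weylAt (g : FormField I M) (x : M) (X₁ X₂ X₃ X₄ : E) : ℝ :=
  metricAt g x (weyl (inChart g x) (extChartAt I x x) X₁ X₂ X₃) X₄

/-- `𝒰_S`: the points at which `S ≠ (κ / n) g`. -/
def setUS (g : FormField I M) : Set M :=
  {x | ¬ ∀ X Y : E, ricciAt g x X Y = scalarAt g x / (finrank ℝ E : ℝ) * metricAt g x X Y}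

/-- `𝒰_C`: the points at which `C ≠ 0`. -/
def setUC (g : FormField I M) : Set M :=
  {x | ¬ ∀ X₁ X₂ X₃ X₄ : E, weylAt g x X₁ X₂ X₃ X₄ = 0}

/-- `(M, g)` is a Roter type manifold: a semi-Riemannian manifold of dimension at least `4` with
`R = (φ/2) S ∧ S + μ g ∧ S + (η/2) g ∧ g` on `𝒰_S ∩ 𝒰_C` for some functions `φ`, `μ`, `η`. -/
structure IsRoterType (g : FormField I M) : Prop where
  semiRiemannian : IsSemiRiemannian g
  four_le_dim : 4 ≤ finrank ℝ E
  roter : ∃ φ μ η : M → ℝ, ∀ x ∈ setUS g ∩ setUC g, ∀ X₁ X₂ X₃ X₄ : E,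
    riemannAt g x X₁ X₂ X₃ X₄ =
      φ x / 2 * kulkarniNomizu (ricciAt g x) (ricciAt g x) X₁ X₂ X₃ X₄ +
      μ x * kulkarniNomizu (metricAt g x) (ricciAt g x) X₁ X₂ X₃ X₄ +
      η x / 2 * kulkarniNomizu (metricAt g x) (metricAt g x) X₁ X₂ X₃ X₄

/-- Constant (sectional) curvature: `R = K G` with `K` a constant and
`G(X₁,X₂,X₃,X₄) = g((X₁ ∧_g X₂)X₃, X₄)`. -/
def HasConstantCurvature (g : FormField I M) : Prop :=
  ∃ K : ℝ, ∀ (x : M) (X₁ X₂ X₃ X₄ : E),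
    riemannAt g x X₁ X₂ X₃ X₄ = K * metricAt g x (wedgeEnd (metricAt g x) X₁ X₂ X₃) X₄

end Tensors

/-! ### Geodesics and geodesic mappings -/

/-- The velocity at time `t` of a curve `γ`, in the preferred chart around `γ t`. -/
def velocity (I : ModelWithCorners ℝ E H) (γ : ℝ → M) (t : ℝ) : E :=
  deriv (fun s => extChartAt I (γ t) (γ s)) t

/-- The covariant acceleration `∇_{γ'} γ' = c'' + Γ(c', c')` at time `t`, in the preferred chart
around `γ t`, where `c` is the curve in that chart. -/
def acceleration (g : FormField I M) (γ : ℝ → M) (t : ℝ) : E :=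
  deriv (deriv (fun s => extChartAt I (γ t) (γ s))) t +
    christoffel (inChart g (γ t)) (extChartAt I (γ t) (γ t)) (velocity I γ t) (velocity I γ t)

/-- `γ` is an affinely parametrized geodesic on `s`. -/
def IsGeodesicOn (g : FormField I M) (γ : ℝ → M) (s : Set ℝ) : Prop :=
  ContMDiffOn 𝓘(ℝ, ℝ) I ∞ γ s ∧ ∀ t ∈ s, acceleration g γ t = 0

/-- `γ` is a geodesic line on `s` in an arbitrary parametrization: `∇_{γ'} γ' = ρ γ'`. -/
def IsPregeodesicOn (g : FormField I M) (γ : ℝ → M) (s : Set ℝ) : Prop :=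
  ContMDiffOn 𝓘(ℝ, ℝ) I ∞ γ s ∧ ∃ ρ : ℝ → ℝ, ∀ t ∈ s, acceleration g γ t = ρ t • velocity I γ t

/-- A geodesic mapping: a diffeomorphism of semi-Riemannian manifolds that maps geodesic lines into
geodesic lines. -/
structure IsGeodesicMapping (g : FormField I M) (g' : FormField I' M')
    (h : M ≃ₘ^∞⟮I, I'⟯ M') : Prop where
  source : IsSemiRiemannian g
  target : IsSemiRiemannian g'
  maps_geodesics : ∀ (γ : ℝ → M) (s : Set ℝ), IsOpen s → s.OrdConnected →
    IsGeodesicOn g γ s → IsPregeodesicOn g' (h ∘ γ) s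

/-- The quotient `det g' / det g` in common coordinates, that is, the determinant of the endomorphism
`g_x⁻¹ ∘ (h^* g')_x` of the tangent space at `x`. -/
def detRatio (g : FormField I M) (g' : FormField I' M') (h : M ≃ₘ^∞⟮I, I'⟯ M') (x : M) : ℝ :=
  LinearMap.det ((g x).inverse ∘L (pullback I h g' x)).toLinearMap

/-- The covector field `ψ = d (log |det g' / det g|) / (2 (n + 1))` of a geodesic mapping. -/
def projectiveCovector (g : FormField I M) (g' : FormField I' M') (h : M ≃ₘ^∞⟮I, I'⟯ M') (x : M) :
    TangentSpace I x →L[ℝ] ℝ :=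
  mfderiv I 𝓘(ℝ, ℝ)
    (fun y => 1 / (2 * ((finrank ℝ E : ℝ) + 1)) * Real.log |detRatio g g' h y|) x

/-- A geodesic mapping is non-trivial if its covector field `ψ` is non-zero (at every point). -/
def IsNontrivialMapping (g : FormField I M) (g' : FormField I' M') (h : M ≃ₘ^∞⟮I, I'⟯ M') : Prop :=
  ∀ x : M, projectiveCovector g g' h x ≠ 0

/-- The warped product metric `π₁^* g + (F ∘ π₁) π₂^* g'` on the product manifold; the warping function
`F` is nowhere zero. -/
def warpedProduct (g : FormField I M) (F : M → ℝ) (g' : FormField I' M') :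
    FormField (I.prod I') (M × M') :=
  fun z => pullback (I.prod I') Prod.fst g z + F z.1 • pullback (I.prod I') Prod.snd g' z

end Manifold

/-! ### The two-dimensional bases -/

/-- The field of forms `a(x¹) (dx¹)² + b(x¹) (dx²)²` on the coordinate plane. -/
def planeForm (a b : ℝ → ℝ) : FormField 𝓘(ℝ, ℝ × ℝ) (ℝ × ℝ) :=
  fun z => show (ℝ × ℝ) →L[ℝ] (ℝ × ℝ) →L[ℝ] ℝ from
    a z.1 • (ContinuousLinearMap.fst ℝ ℝ ℝ).smulRight (ContinuousLinearMap.fst ℝ ℝ ℝ) +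
    b z.1 • (ContinuousLinearMap.snd ℝ ℝ ℝ).smulRight (ContinuousLinearMap.snd ℝ ℝ ℝ)

/-- Its restriction to an open set `U` of the coordinate plane. -/
def baseMetric (U : TopologicalSpace.Opens (ℝ × ℝ)) (a b : ℝ → ℝ) :
    FormField 𝓘(ℝ, ℝ × ℝ) U :=
  pullback 𝓘(ℝ, ℝ × ℝ) (Subtype.val : U → ℝ × ℝ) (planeForm a b)

end Roter

end

/-! The two warped products are of one kind, so that the assertions on `g` and on its conjugate are two
instances of the same computation: the conjugate base arises from `b̄ = p b / (1 + q b)`, with the same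
`C` and with `D̄ = (D + 4 C q) / p` (`IsRoterBase.conj`).

In the coordinate `t = b(x¹)` the base metric is `dt² / (t (D t - 4 C)) + t (dx²)²`. It has constant
curvature `c = -D / 4`, and the warping function is `f²` up to sign, where `f = √|t| B(x²)` satisfies
`Hess f = -c f g`. Hence all sectional curvatures of the warped product are `c`, except for those of
the planes tangent to the fiber (`hasSplitCurvature_warpForm`). The fiber has at each point the
curvature tensor of a space form of curvature `K = κ / ((n - 3)(n - 2))`: for `n = 4` because it is a
surface, for `n ≥ 5` by hypothesis (`hasSplitCurvature_of_hasConstantCurvature`). So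
`R = (c / 2) g ∧ g + (l / 2) P ∧ P` where `P` is the fiber part of `g` and
`l = (K - (B'² - C B²)) / F`.

The Ricci tensor is then a combination of `g` and `P`, in which `P` occurs with the coefficient
`l (n - 3)`. If `l ≠ 0`, then `P` is a combination of `S` and `g`, which gives the Roter equation
(`HasSplitCurvature.exists_roter`), and neither `S - (κ / n) g` nor the Weyl tensor vanishes; if
`l = 0`, the Ricci tensor is Einstein (`HasSplitCurvature.mem_setUS_inter_setUC_iff`).

The geodesic mappings are the identity maps. The two connections differ by `ψ ⊗ id + id ⊗ ψ` where
`ψ = d (-½ log |1 + q b|)` (`IsRoterBase.christoffel_warpForm_conj`), so the acceleration of a geodesic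
of the first metric with respect to the second one is `2 ψ(γ') γ'`. The determinants of the two
metrics have the quotient `pⁿ / (1 + q b)ⁿ⁺¹`, which identifies this `ψ` with the covector field of the
mapping, and it vanishes nowhere because `q b' ≠ 0`. -/

noncomputable section

namespace Roter

open Filter Topology

/-! ### Metrics in a coordinate domain -/

section LocalTheory

variable {E : Type*} [NormedAddCommGroup E] [NormedSpace ℝ E]

/-- `G` is a metric of class `C²` near `z`: twice continuously differentiable, symmetric at the points
near `z`, and nondegenerate at `z`. Second order is all the curvature needs, and unlike smoothness
at a point it propagates to neighbouring points. -/
structure IsMetricNear (G : E → E →L[ℝ] E →L[ℝ] ℝ) (z : E) : Prop where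
  contDiffAt : ContDiffAt ℝ 2 G z
  symm : ∀ᶠ w in 𝓝 z, ∀ u v, G w u v = G w v u
  invertible : (G z).IsInvertible

variable {G G' : E → E →L[ℝ] E →L[ℝ] ℝ} {z : E}

lemma IsMetricNear.eventually [FiniteDimensional ℝ E] (h : IsMetricNear G z) :
    ∀ᶠ w in 𝓝 z, IsMetricNear G w := by
  have : CompleteSpace E := FiniteDimensional.complete ℝ E
  have hinv : ∀ᶠ w in 𝓝 z, (G w).IsInvertible := by
    obtain ⟨e, he⟩ := h.invertible
    have := h.contDiffAt.continuousAt.eventually (he ▸ ContinuousLinearEquiv.nhds e)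
    filter_upwards [this] with w hw using hw
  filter_upwards [h.contDiffAt.eventually (by simp), h.symm.eventually_nhds, hinv] with w h1 h2 h3
  exact ⟨h1, h2, h3⟩

lemma IsMetricNear.differentiableAt (h : IsMetricNear G z) : DifferentiableAt ℝ G z :=
  h.contDiffAt.differentiableAt (by simp)

lemma fderiv_apply_apply (hG : DifferentiableAt ℝ G z) (u v w : E) :
    fderiv ℝ (fun x => G x v w) z u = fderiv ℝ G z u v w := by
  have h1 : HasFDerivAt (fun x => G x v) ((fderiv ℝ G z).flip v) z := by
    simpa using hG.hasFDerivAt.clm_apply (hasFDerivAt_const v z)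
  have h2 := h1.clm_apply (hasFDerivAt_const w z)
  rw [h2.fderiv]; simp

lemma IsMetricNear.fderiv_symm (h : IsMetricNear G z) (u v w : E) :
    fderiv ℝ G z u v w = fderiv ℝ G z u w v := by
  rw [← fderiv_apply_apply h.differentiableAt, ← fderiv_apply_apply h.differentiableAt]
  have : (fun x => G x v w) =ᶠ[𝓝 z] fun x => G x w v := by
    filter_upwards [h.symm] with x hx using hx v w
  rw [this.fderiv_eq (𝕜 := ℝ)]

lemma apply_christoffel (h : (G z).IsInvertible) (u v w : E) :
    G z (christoffel G z u v) w = christoffelLower G z u v w := by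
  rw [christoffel_apply, h.self_apply_inverse]

lemma christoffel_eq (h : (G z).IsInvertible) {u v x : E}
    (hx : ∀ w, G z x w = christoffelLower G z u v w) : christoffel G z u v = x := by
  rw [christoffel_apply, h.inverse_apply_eq]
  ext w; exact (hx w).symm

/-- The Levi-Civita connection is compatible with the metric. -/
lemma IsMetricNear.fderiv_eq (h : IsMetricNear G z) (u v w : E) :
    fderiv ℝ G z u v w = G z (christoffel G z u v) w + G z v (christoffel G z u w) := by
  rw [h.symm.self_of_nhds v, apply_christoffel h.invertible, apply_christoffel h.invertible,
    christoffelLower_apply, christoffelLower_apply, h.fderiv_symm u w v, h.fderiv_symm v u w,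
    h.fderiv_symm w u v]
  ring

lemma christoffel_eventuallyEq (h : G =ᶠ[𝓝 z] G') : christoffel G =ᶠ[𝓝 z] christoffel G' := by
  filter_upwards [h, h.fderiv (𝕜 := ℝ)] with w h1 h2
  simp only [christoffel, christoffelLower, h1, h2]

lemma curvature_congr (h : G =ᶠ[𝓝 z] G') : curvature G z = curvature G' z := by
  have h1 := christoffel_eventuallyEq h
  simp only [curvature, h1.fderiv_eq, h1.self_of_nhds]

variable [FiniteDimensional ℝ E]

lemma IsMetricNear.differentiableAt_christoffel (h : IsMetricNear G z) :
    DifferentiableAt ℝ (christoffel G) z := by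
  have : CompleteSpace E := FiniteDimensional.complete ℝ E
  have h1 : DifferentiableAt ℝ (fun w => (G w).inverse) z :=
    ((h.invertible.contDiffAt_map_inverse (n := 1)).differentiableAt (by simp)).comp z
      h.differentiableAt
  have h2 : DifferentiableAt ℝ (fderiv ℝ G) z :=
    (h.contDiffAt.fderiv_right (m := 1) (by norm_num)).differentiableAt (by simp)
  have h3 : DifferentiableAt ℝ (fun w => (fderiv ℝ G w).flip) z :=
    ((ContinuousLinearMap.flipₗᵢ ℝ E E (E →L[ℝ] ℝ)).toContinuousLinearEquiv.differentiableAt).comp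
      z h2
  have h4 : DifferentiableAt ℝ (christoffelLower G) z := by
    unfold christoffelLower
    exact ((h2.add h3).sub ((differentiableAt_const _).clm_comp h3)).const_smul (2⁻¹ : ℝ)
  unfold christoffel
  exact ((ContinuousLinearMap.differentiableAt _).comp z h1).clm_comp h4

lemma IsMetricNear.fderiv_christoffel_apply (h : IsMetricNear G z) (u v w : E) :
    fderiv ℝ (christoffel G) z u v w = fderiv ℝ (fun x => christoffel G x v w) z u := by
  have := (h.differentiableAt_christoffel.hasFDerivAt.clm_apply (hasFDerivAt_const v z)).clm_apply
    (hasFDerivAt_const w z)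
  rw [this.fderiv]; simp

/-- The endomorphism `ℛ(u,v)` is skew-adjoint: the second derivatives of the metric in the
directions `u`, `v` commute, and metric compatibility turns this into the claim. -/
lemma IsMetricNear.curvature_skew (h : IsMetricNear G z) (u v w x : E) :
    G z (curvature G z u v w) x = - G z w (curvature G z u v x) := by
  have hΓ := h.differentiableAt_christoffel.hasFDerivAt
  have hG := h.differentiableAt.hasFDerivAt
  have key (u v : E) : fderiv ℝ (fderiv ℝ G) z u v w x =
      fderiv ℝ G z u (christoffel G z v w) x + G z (fderiv ℝ (christoffel G) z u v w) x +
      (fderiv ℝ G z u w (christoffel G z v x) + G z w (fderiv ℝ (christoffel G) z u v x)) := by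
    have hD : DifferentiableAt ℝ (fderiv ℝ G) z :=
      (h.contDiffAt.fderiv_right (m := 1) (by norm_num)).differentiableAt (by simp)
    have e1 := ((hD.hasFDerivAt.clm_apply (hasFDerivAt_const v z)).clm_apply
      (hasFDerivAt_const w z)).clm_apply (hasFDerivAt_const x z)
    have a (w : E) := (hΓ.clm_apply (hasFDerivAt_const v z)).clm_apply (hasFDerivAt_const w z)
    have e2 := ((hG.clm_apply (a w)).clm_apply (hasFDerivAt_const x z)).add
      ((hG.clm_apply (hasFDerivAt_const w z)).clm_apply (a x))
    have e3 : (fun y => fderiv ℝ G y v w x) =ᶠ[𝓝 z] fun y =>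
        G y (christoffel G y v w) x + G y w (christoffel G y v x) := by
      filter_upwards [h.eventually] with y hy using hy.fderiv_eq v w x
    have := (e2.congr_of_eventuallyEq e3).unique e1
    have := congrArg (fun L => L u) this
    simp at this
    linarith
  have hs := (h.contDiffAt.isSymmSndFDerivAt (by simp)) u v
  have hs' := congrArg (fun L => L w x) hs
  simp only [key, h.fderiv_eq] at hs'
  simp only [curvature_apply, map_add, map_sub, add_apply, _root_.sub_apply]
  linarith

/-- A curvature operator that is a combination of the curvature of a space form and of the curvature
of a space form on the range of a self-adjoint projection `π`:
`ℛ(X,Y)Z = c (X ∧ Y) Z + l (πX ∧ πY) Z`. -/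
structure HasSplitCurvature (G : E → E →L[ℝ] E →L[ℝ] ℝ) (z : E) (c l : ℝ) (π : E →ₗ[ℝ] E) :
    Prop where
  invertible : (G z).IsInvertible
  symm : ∀ X Y, G z X Y = G z Y X
  idem : ∀ X, π (π X) = π X
  selfAdjoint : ∀ X Y, G z (π X) Y = G z X (π Y)
  curvature_eq : ∀ X Y Z, curvature G z X Y Z =
    c • (G z Y Z • X - G z X Z • Y) + l • (G z (π Y) Z • π X - G z (π X) Z • π Y)

namespace HasSplitCurvature

variable {c l : ℝ} {π : E →ₗ[ℝ] E}

lemma ricci_eq (h : HasSplitCurvature G z c l π) (X Y : E) :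
    ricci G z X Y = c * ((finrank ℝ E : ℝ) - 1) * G z X Y +
      l * (LinearMap.trace ℝ E π - 1) * G z (π X) Y := by
  rw [ricci_apply]
  have e : ({ toFun := fun Z => curvature G z Z X Y
              map_add' := by intros; simp
              map_smul' := by intros; simp } : E →ₗ[ℝ] E) =
      c • (G z X Y • LinearMap.id - (((G z).flip Y).toLinearMap).smulRight X) +
      l • (G z (π X) Y • π - (((G z).flip Y).toLinearMap ∘ₗ π).smulRight (π X)) := by
    ext Z
    simp [h.curvature_eq]
  rw [e]
  simp only [map_add, map_sub, map_smul, LinearMap.trace_id, LinearMap.trace_smulRight, smul_eq_mul]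
  simp [h.idem]
  ring

lemma ricciOp_eq (h : HasSplitCurvature G z c l π) (X : E) :
    ricciOp G z X = (c * ((finrank ℝ E : ℝ) - 1)) • X +
      (l * (LinearMap.trace ℝ E π - 1)) • π X := by
  have : ricciOp G z X = (G z).inverse (LinearMap.toContinuousLinearMap (ricci G z X)) := rfl
  rw [this, h.invertible.inverse_apply_eq]
  ext Y
  simp [h.ricci_eq]

lemma scalar_eq (h : HasSplitCurvature G z c l π) :
    scalar G z = c * ((finrank ℝ E : ℝ) - 1) * finrank ℝ E +
      l * (LinearMap.trace ℝ E π - 1) * LinearMap.trace ℝ E π := by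
  have : ricciOp G z = (c * ((finrank ℝ E : ℝ) - 1)) • LinearMap.id +
      (l * (LinearMap.trace ℝ E π - 1)) • π := by
    ext X; simp [h.ricciOp_eq]
  rw [scalar, this]
  simp

end HasSplitCurvature

/-- In dimension two every metric has pointwise constant curvature. -/
lemma IsMetricNear.exists_curvature_eq_of_finrank_eq_two (h : IsMetricNear G z)
    (hE : finrank ℝ E = 2) : ∃ K : ℝ, HasSplitCurvature G z K 0 0 := by
  let β := Module.finBasisOfFinrankEq ℝ E hE
  have hs := h.symm.self_of_nhds
  set e := β 0
  set f := β 1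
  have hX (X : E) : X = β.repr X 0 • e + β.repr X 1 • f := by
    conv_lhs => rw [← β.sum_repr X, Fin.sum_univ_two]
  -- a `g`-skew endomorphism of a plane is determined by the single number `s = g(R(e,f)f, e)`
  set s := G z (curvature G z e f f) e with hs_def
  set d := G z e e * G z f f - G z e f * G z e f with hd_def
  have halt (u : E) : curvature G z u u = 0 := by ext w; simp [curvature_apply]
  have hanti (u v : E) : curvature G z u v = - curvature G z v u := by
    ext w; simp only [curvature_apply, _root_.neg_apply]; abel
  have hnd (x y : E) (h1 : G z x e = G z y e) (h2 : G z x f = G z y f) : x = y := by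
    apply h.invertible.injective
    ext w
    rw [hX w]; simp [h1, h2]
  have s1 := h.curvature_skew e f e e
  have s2 := h.curvature_skew e f f f
  have s3 := h.curvature_skew e f e f
  rw [hs e] at s1 s3
  rw [hs f (curvature G z e f f)] at s2
  have z1 : G z (curvature G z e f e) e = 0 := by
    have := hs (curvature G z e f e) e; linarith
  have z2 : G z (curvature G z e f f) f = 0 := by
    have := hs (curvature G z e f f) f; linarith
  have hd : d ≠ 0 := by
    intro hd0
    have h1 : G z e f • e = G z e e • f := hnd _ _ (by simp [hs f e]; ring)
      (by simp; linarith)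
    have h2 : G z e f = 0 ∧ G z e e = 0 := by
      constructor
      · have := congrArg (fun x => β.repr x 0) h1
        simpa [e, f] using this
      · have := congrArg (fun x => β.repr x 1) h1
        simpa [e, f] using this.symm
    have h3 : e = 0 := hnd _ _ (by simp [h2]) (by simp [h2])
    exact β.ne_zero 0 h3
  refine ⟨s / d, h.invertible, hs, by simp, by simp, fun X Y Z => ?_⟩
  have base (Z : E) : curvature G z e f Z = (s / d) • (G z f Z • e - G z e Z • f) := by
    have b1 : curvature G z e f e = (s / d) • (G z f e • e - G z e e • f) := by
      apply hnd
      · rw [z1]; simp [hs f e]; right; ring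
      · have : G z (curvature G z e f e) f = -s := by
          rw [hs_def, hs _ e]; have := h.curvature_skew e f e f; linarith
        rw [this]; simp [hs f e]
        field_simp; rw [hd_def]; ring
    have b2 : curvature G z e f f = (s / d) • (G z f f • e - G z e f • f) := by
      apply hnd
      · rw [← hs_def]; simp [hs f e]
        field_simp; rw [hd_def]; ring
      · rw [z2]; simp; right; ring
    rw [hX Z]
    simp only [map_add, map_smul, b1, b2, smul_eq_mul]
    module
  obtain ⟨x₀, x₁, rfl⟩ : ∃ x₀ x₁ : ℝ, X = x₀ • e + x₁ • f := ⟨_, _, hX X⟩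
  obtain ⟨y₀, y₁, rfl⟩ : ∃ y₀ y₁ : ℝ, Y = y₀ • e + y₁ • f := ⟨_, _, hX Y⟩
  simp only [map_add, map_smul, add_apply, _root_.smul_apply, halt, hanti f e, _root_.neg_apply,
    _root_.zero_apply, base, smul_eq_mul, LinearMap.zero_apply]
  module

end LocalTheory

/-! ### Warped products in a coordinate domain -/

section WarpedLocal

lemma isInvertible_of_nondegenerate {E : Type*} [NormedAddCommGroup E] [NormedSpace ℝ E]
    [FiniteDimensional ℝ E] (A : E →L[ℝ] E →L[ℝ] ℝ) (hA : ∀ u, (∀ v, A u v = 0) → u = 0) :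
    A.IsInvertible := by
  have hinj : Function.Injective A.toLinearMap := by
    rw [← LinearMap.ker_eq_bot, LinearMap.ker_eq_bot']
    intro u hu
    exact hA u fun v => by rw [show A u = 0 from hu]; rfl
  have hdim : finrank ℝ E = finrank ℝ (E →L[ℝ] ℝ) := by
    rw [← (LinearMap.toContinuousLinearMap : (E →ₗ[ℝ] ℝ) ≃ₗ[ℝ] (E →L[ℝ] ℝ)).finrank_eq,
      Subspace.dual_finrank_eq]
  let e := (LinearEquiv.ofInjectiveOfFinrankEq A.toLinearMap hinj hdim).toContinuousLinearEquiv
  exact ⟨e, by ext; rfl⟩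

variable {E : Type*} [NormedAddCommGroup E] [NormedSpace ℝ E]
  {V : Type*} [NormedAddCommGroup V] [NormedSpace ℝ V]

lemma IsMetricNear.christoffel_symm {G : E → E →L[ℝ] E →L[ℝ] ℝ} {z : E} (h : IsMetricNear G z)
    (u v : E) : christoffel G z u v = christoffel G z v u := by
  apply christoffel_eq h.invertible
  intro w
  rw [apply_christoffel h.invertible, christoffelLower_apply, christoffelLower_apply,
    h.fderiv_symm w u v]
  ring

/-- The warped product `g + φ h` of forms on coordinate domains of `E` and `V`. -/
def warpForm (g : E → E →L[ℝ] E →L[ℝ] ℝ) (φ : E → ℝ) (h : V → V →L[ℝ] V →L[ℝ] ℝ) :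
    E × V → (E × V) →L[ℝ] (E × V) →L[ℝ] ℝ := fun z =>
  (g z.1).bilinearComp (ContinuousLinearMap.fst ℝ E V) (ContinuousLinearMap.fst ℝ E V) +
    φ z.1 • (h z.2).bilinearComp (ContinuousLinearMap.snd ℝ E V) (ContinuousLinearMap.snd ℝ E V)

variable {g : E → E →L[ℝ] E →L[ℝ] ℝ} {φ : E → ℝ} {h : V → V →L[ℝ] V →L[ℝ] ℝ} {z : E × V}

@[simp] lemma warpForm_apply (u v : E × V) :
    warpForm g φ h z u v = g z.1 u.1 v.1 + φ z.1 * h z.2 u.2 v.2 := rfl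

/-- Pulling a form back along a fixed linear map is continuous and linear in the form. -/
lemma contDiffAt_bilinearComp {X : Type*} [NormedAddCommGroup X] [NormedSpace ℝ X]
    {Y : Type*} [NormedAddCommGroup Y] [NormedSpace ℝ Y] {n : WithTop ℕ∞}
    {k : X → Y →L[ℝ] Y →L[ℝ] ℝ} {x : X} (hk : ContDiffAt ℝ n k x) (P : X →L[ℝ] Y) :
    ContDiffAt ℝ n (fun x => (k x).bilinearComp P P) x := by
  have e : (fun x => (k x).bilinearComp P P) = fun x =>
      (ContinuousLinearMap.precomp ℝ P) ∘L ((k x) ∘L P) := rfl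
  rw [e]
  exact contDiffAt_const.clm_comp (hk.clm_comp contDiffAt_const)

lemma contDiffAt_warpForm {n : WithTop ℕ∞} (hg : ContDiffAt ℝ n g z.1)
    (hφ : ContDiffAt ℝ n φ z.1) (hh : ContDiffAt ℝ n h z.2) :
    ContDiffAt ℝ n (warpForm g φ h) z := by
  have hg' : ContDiffAt ℝ n (fun z : E × V => g z.1) z := hg.comp z contDiffAt_fst
  have hφ' : ContDiffAt ℝ n (fun z : E × V => φ z.1) z := hφ.comp z contDiffAt_fst
  have hh' : ContDiffAt ℝ n (fun z : E × V => h z.2) z := hh.comp z contDiffAt_snd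
  exact (contDiffAt_bilinearComp hg' _).add (hφ'.smul (contDiffAt_bilinearComp hh' _))

lemma isMetricNear_warpForm [FiniteDimensional ℝ E] [FiniteDimensional ℝ V]
    (hg : IsMetricNear g z.1) (hφ : ContDiffAt ℝ 2 φ z.1)
    (hφ0 : φ z.1 ≠ 0) (hh : IsMetricNear h z.2) : IsMetricNear (warpForm g φ h) z where
  contDiffAt := contDiffAt_warpForm hg.contDiffAt hφ hh.contDiffAt
  symm := by
    have h1 := continuousAt_fst.eventually hg.symm
    have h2 := continuousAt_snd.eventually hh.symm
    filter_upwards [h1, h2] with w hw1 hw2 u v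
    simp [hw1 u.1, hw2 u.2]
  invertible := by
    refine isInvertible_of_nondegenerate _ fun u hu => ?_
    refine Prod.ext (hg.invertible.injective ?_) (hh.invertible.injective ?_)
    · ext v; simpa using hu (v, 0)
    · ext v; simpa [hφ0] using hu (0, v)

lemma fderiv_warpForm {φ' : E →L[ℝ] ℝ} (hg : DifferentiableAt ℝ g z.1)
    (hφ : HasFDerivAt φ φ' z.1) (hh : DifferentiableAt ℝ h z.2)
    (hW : DifferentiableAt ℝ (warpForm g φ h) z) (u v w : E × V) :
    fderiv ℝ (warpForm g φ h) z u v w = fderiv ℝ g z.1 u.1 v.1 w.1 +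
      (φ' u.1 * h z.2 v.2 w.2 + φ z.1 * fderiv ℝ h z.2 u.2 v.2 w.2) := by
  rw [← fderiv_apply_apply hW]
  have d1 : DifferentiableAt ℝ (fun x => g x v.1 w.1) z.1 := by fun_prop
  have d2 : DifferentiableAt ℝ (fun x => h x v.2 w.2) z.2 := by fun_prop
  have a1 : HasFDerivAt (fun x : E × V => g x.1 v.1 w.1) _ z :=
    HasFDerivAt.comp (g := fun x => g x v.1 w.1) z d1.hasFDerivAt hasFDerivAt_fst
  have a2 : HasFDerivAt (fun x : E × V => h x.2 v.2 w.2) _ z :=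
    HasFDerivAt.comp (g := fun x => h x v.2 w.2) z d2.hasFDerivAt hasFDerivAt_snd
  have a3 : HasFDerivAt (fun x : E × V => φ x.1) _ z := hφ.comp z hasFDerivAt_fst
  have := (a1.add (a3.mul a2)).fderiv
  simp only [warpForm_apply]
  refine (congrArg (fun L => L u) this).trans ?_
  simp [fderiv_apply_apply hg, fderiv_apply_apply hh]
  ring

/-- The Levi-Civita connection of a warped product. The logarithmic derivative of the warping
function is `dφ = 2 φ θ`, and `N` is half the gradient of `φ`. -/
lemma christoffel_warpForm [FiniteDimensional ℝ E] [FiniteDimensional ℝ V]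
    (hg : IsMetricNear g z.1) (hh : IsMetricNear h z.2) {θ : E →L[ℝ] ℝ} {N : E}
    (hφ2 : ContDiffAt ℝ 2 φ z.1) (hφ : HasFDerivAt φ ((2 * φ z.1) • θ) z.1) (hφ0 : φ z.1 ≠ 0)
    (hN : ∀ v, g z.1 N v = φ z.1 * θ v) (u v : E × V) :
    christoffel (warpForm g φ h) z u v =
      (christoffel g z.1 u.1 v.1 - h z.2 u.2 v.2 • N,
        christoffel h z.2 u.2 v.2 + θ u.1 • v.2 + θ v.1 • u.2) := by
  have hW := isMetricNear_warpForm hg hφ2 hφ0 hh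
  apply christoffel_eq hW.invertible
  intro w
  rw [christoffelLower_apply, fderiv_warpForm hg.differentiableAt hφ hh.differentiableAt
    hW.differentiableAt, fderiv_warpForm hg.differentiableAt hφ hh.differentiableAt
    hW.differentiableAt, fderiv_warpForm hg.differentiableAt hφ hh.differentiableAt
    hW.differentiableAt]
  simp only [warpForm_apply, map_sub, map_add, map_smul, add_apply, _root_.sub_apply,
    _root_.smul_apply, smul_eq_mul, hN, apply_christoffel hg.invertible,
    apply_christoffel hh.invertible, christoffelLower_apply]
  rw [hh.symm.self_of_nhds u.2 w.2]
  ring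

lemma trace_prodMap_zero_id [FiniteDimensional ℝ E] [FiniteDimensional ℝ V] :
    LinearMap.trace ℝ (E × V) (LinearMap.prodMap (0 : E →ₗ[ℝ] E) (LinearMap.id : V →ₗ[ℝ] V)) =
      finrank ℝ V := by
  rw [LinearMap.trace_prodMap']; simp

/-- The curvature of the warped product of a base of constant curvature `c` whose warping function
is `φ = f²` (up to sign) with `Hess f = -c f g`, and of a fiber of curvature `K` at the point.
With `θ = df / f` and `N = (φ / f) grad f` the equation for the Hessian reads `∇N = θ ⊗ N - c φ` and,
equivalently, `∇θ = -c g - θ ⊗ θ`. All sectional curvatures are then `c`, but for the planes tangent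
to the fiber. -/
lemma hasSplitCurvature_warpForm [FiniteDimensional ℝ E] [FiniteDimensional ℝ V]
    (hg : IsMetricNear g z.1) (hh : IsMetricNear h z.2) {θ : E → E →L[ℝ] ℝ} {N : E → E}
    (hφ2 : ContDiffAt ℝ 2 φ z.1) (hφ0 : φ z.1 ≠ 0)
    (hφ : ∀ᶠ x in 𝓝 z.1, HasFDerivAt φ ((2 * φ x) • θ x) x)
    (hN : ∀ᶠ x in 𝓝 z.1, ∀ v, g x (N x) v = φ x * θ x v)
    {θ' : E →L[ℝ] E →L[ℝ] ℝ} (hθ : HasFDerivAt θ θ' z.1)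
    {N' : E →L[ℝ] E} (hN' : HasFDerivAt N N' z.1) {c K : ℝ}
    (hc : HasSplitCurvature g z.1 c 0 0) (hK : HasSplitCurvature h z.2 K 0 0)
    (hθc : ∀ u v, θ' u v = θ z.1 (christoffel g z.1 u v) - c * g z.1 u v - θ z.1 u * θ z.1 v)
    (hNc : ∀ u, N' u = θ z.1 u • N z.1 - (c * φ z.1) • u - christoffel g z.1 u (N z.1)) :
    HasSplitCurvature (warpForm g φ h) z c ((K - θ z.1 (N z.1)) / φ z.1 - c)
      (LinearMap.prodMap 0 LinearMap.id) := by
  have hW := isMetricNear_warpForm hg hφ2 hφ0 hh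
  refine ⟨hW.invertible, hW.symm.self_of_nhds, by simp, by simp, fun X Y Z => ?_⟩
  have hΓ : ∀ᶠ x in 𝓝 z, ∀ u v, christoffel (warpForm g φ h) x u v =
      (christoffel g x.1 u.1 v.1 - h x.2 u.2 v.2 • N x.1,
        christoffel h x.2 u.2 v.2 + θ x.1 u.1 • v.2 + θ x.1 v.1 • u.2) := by
    have h0 : ∀ᶠ x in 𝓝 z.1, φ x ≠ 0 := hφ2.continuousAt.eventually_ne hφ0
    filter_upwards [continuousAt_fst.eventually hg.eventually,
      continuousAt_snd.eventually hh.eventually, continuousAt_fst.eventually hφ,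
      continuousAt_fst.eventually hN, continuousAt_fst.eventually h0,
      continuousAt_fst.eventually (hφ2.eventually (by simp))] with x x1 x2 x3 x4 x5 x6 u v
    exact christoffel_warpForm x1 x2 x6 x3 x5 x4 u v
  have hD (u v w : E × V) : fderiv ℝ (christoffel (warpForm g φ h)) z u v w =
      (fderiv ℝ (christoffel g) z.1 u.1 v.1 w.1 - fderiv ℝ h z.2 u.2 v.2 w.2 • N z.1 -
          h z.2 v.2 w.2 • N' u.1,
        fderiv ℝ (christoffel h) z.2 u.2 v.2 w.2 + θ' u.1 v.1 • w.2 + θ' u.1 w.1 • v.2) := by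
    rw [hW.fderiv_christoffel_apply]
    have e : (fun x => christoffel (warpForm g φ h) x v w) =ᶠ[𝓝 z] fun x =>
        (christoffel g x.1 v.1 w.1 - h x.2 v.2 w.2 • N x.1,
          christoffel h x.2 v.2 w.2 + θ x.1 v.1 • w.2 + θ x.1 w.1 • v.2) := by
      filter_upwards [hΓ] with x hx using hx v w
    have dg := hg.differentiableAt_christoffel
    have dh := hh.differentiableAt_christoffel
    have dh0 := hh.differentiableAt
    have d1 : DifferentiableAt ℝ (fun x => christoffel g x v.1 w.1) z.1 := by fun_prop
    have d2 : DifferentiableAt ℝ (fun x => h x v.2 w.2) z.2 := by fun_prop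
    have d3 : DifferentiableAt ℝ (fun x => christoffel h x v.2 w.2) z.2 := by fun_prop
    have a1 : HasFDerivAt (fun x : E × V => christoffel g x.1 v.1 w.1) _ z :=
      HasFDerivAt.comp (g := fun x => christoffel g x v.1 w.1) z d1.hasFDerivAt hasFDerivAt_fst
    have a2 : HasFDerivAt (fun x : E × V => h x.2 v.2 w.2) _ z :=
      HasFDerivAt.comp (g := fun x => h x v.2 w.2) z d2.hasFDerivAt hasFDerivAt_snd
    have a3 : HasFDerivAt (fun x : E × V => N x.1) _ z := hN'.comp z hasFDerivAt_fst
    have a4 : HasFDerivAt (fun x : E × V => christoffel h x.2 v.2 w.2) _ z :=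
      HasFDerivAt.comp (g := fun x => christoffel h x v.2 w.2) z d3.hasFDerivAt hasFDerivAt_snd
    have a5 (y : E) : HasFDerivAt (fun x : E × V => θ x.1 y) _ z :=
      (hθ.comp z (hasFDerivAt_fst (𝕜 := ℝ) (p := z))).clm_apply (hasFDerivAt_const y z)
    have := ((a1.sub (a2.smul a3)).prodMk
      ((a4.add ((a5 v.1).smul_const w.2)).add ((a5 w.1).smul_const v.2))).fderiv
    rw [e.fderiv_eq]
    refine (congrArg (fun L => L u) this).trans ?_
    simp [fderiv_apply_apply dh0, hg.fderiv_christoffel_apply, hh.fderiv_christoffel_apply]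
    abel
  have hcurv1 := hc.curvature_eq X.1 Y.1 Z.1
  have hcurv2 := hK.curvature_eq X.2 Y.2 Z.2
  have hΓz := hΓ.self_of_nhds
  simp only [curvature_apply, zero_smul, add_zero] at hcurv1 hcurv2
  rw [curvature_apply, hD, hD]
  simp only [hΓz]
  have s1 := hh.symm.self_of_nhds
  ext1
  · simp only [Prod.fst_add, Prod.fst_sub, Prod.smul_fst, hNc, hh.fderiv_eq, map_add, map_sub,
      map_smul, warpForm_apply, LinearMap.prodMap_apply, LinearMap.zero_apply, smul_zero,
      sub_zero, add_zero, s1 Y.2 X.2, hh.christoffel_symm Y.2 X.2] at hcurv1 ⊢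
    linear_combination (norm := module) hcurv1
  · simp only [Prod.snd_add, Prod.snd_sub, Prod.smul_snd, hθc, map_add, map_sub,
      map_smul, warpForm_apply, LinearMap.prodMap_apply, LinearMap.id_apply, LinearMap.zero_apply,
      _root_.zero_apply, map_zero, zero_add, smul_eq_mul, hg.christoffel_symm Y.1 X.1,
      hg.symm.self_of_nhds Y.1 X.1, hh.christoffel_symm Y.2 X.2] at hcurv2 ⊢
    have hl (t : ℝ) : ((K - θ z.1 (N z.1)) / φ z.1 - c) * (φ z.1 * t) =
        (K - θ z.1 (N z.1) - c * φ z.1) * t := by field_simp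
    simp only [smul_sub, smul_smul, hl]
    linear_combination (norm := module) hcurv2

end WarpedLocal

/-! ### The two-dimensional base in coordinates -/

section Base

/-- The form `a(x¹) (dx¹)² + b(x¹) (dx²)²`, as a form on the vector space `ℝ × ℝ`. -/
def diagForm (a b : ℝ → ℝ) : ℝ × ℝ → (ℝ × ℝ) →L[ℝ] (ℝ × ℝ) →L[ℝ] ℝ := fun z =>
  a z.1 • (ContinuousLinearMap.fst ℝ ℝ ℝ).smulRight (ContinuousLinearMap.fst ℝ ℝ ℝ) +
    b z.1 • (ContinuousLinearMap.snd ℝ ℝ ℝ).smulRight (ContinuousLinearMap.snd ℝ ℝ ℝ)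

variable {a b B : ℝ → ℝ} {z : ℝ × ℝ}

lemma hasFDerivAt_comp_fst {f : ℝ → ℝ} {f' : ℝ} (hf : HasDerivAt f f' z.1) :
    HasFDerivAt (fun x : ℝ × ℝ => f x.1) (f' • ContinuousLinearMap.fst ℝ ℝ ℝ) z :=
  hf.comp_hasFDerivAt (f := fun x : ℝ × ℝ => x.1) z hasFDerivAt_fst

lemma hasFDerivAt_comp_snd {f : ℝ → ℝ} {f' : ℝ} (hf : HasDerivAt f f' z.2) :
    HasFDerivAt (fun x : ℝ × ℝ => f x.2) (f' • ContinuousLinearMap.snd ℝ ℝ ℝ) z :=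
  hf.comp_hasFDerivAt (f := fun x : ℝ × ℝ => x.2) z hasFDerivAt_snd

lemma two_le_infty : (2 : WithTop ℕ∞) ≤ ∞ :=
  (mod_cast le_top : ((2 : ℕ∞) : WithTop ℕ∞) ≤ ∞)

lemma contDiffAt_deriv {f : ℝ → ℝ} {x : ℝ} (hf : ContDiffAt ℝ ∞ f x) :
    ContDiffAt ℝ ∞ (deriv f) x := by
  have e : deriv f = fun y => fderiv ℝ f y 1 := rfl
  rw [e]
  exact (hf.fderiv_right (by simp)).clm_apply contDiffAt_const

@[simp] lemma diagForm_apply (u v : ℝ × ℝ) :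
    diagForm a b z u v = a z.1 * (u.1 * v.1) + b z.1 * (u.2 * v.2) := by
  simp [diagForm]

lemma contDiffAt_diagForm {n : WithTop ℕ∞} (ha : ContDiffAt ℝ n a z.1)
    (hb : ContDiffAt ℝ n b z.1) : ContDiffAt ℝ n (diagForm a b) z := by
  have ha' : ContDiffAt ℝ n (fun z : ℝ × ℝ => a z.1) z := ha.comp z contDiffAt_fst
  have hb' : ContDiffAt ℝ n (fun z : ℝ × ℝ => b z.1) z := hb.comp z contDiffAt_fst
  exact (ha'.smul contDiffAt_const).add (hb'.smul contDiffAt_const)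

lemma isMetricNear_diagForm (ha : ContDiffAt ℝ 2 a z.1) (hb : ContDiffAt ℝ 2 b z.1)
    (ha0 : a z.1 ≠ 0) (hb0 : b z.1 ≠ 0) : IsMetricNear (diagForm a b) z where
  contDiffAt := contDiffAt_diagForm ha hb
  symm := Eventually.of_forall fun w u v => by simp; ring
  invertible := by
    refine isInvertible_of_nondegenerate _ fun u hu => Prod.ext ?_ ?_
    · simpa [ha0] using hu (1, 0)
    · simpa [hb0] using hu (0, 1)

lemma christoffel_diagForm (ha : ContDiffAt ℝ 2 a z.1) (hb : ContDiffAt ℝ 2 b z.1)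
    (ha0 : a z.1 ≠ 0) (hb0 : b z.1 ≠ 0) (u v : ℝ × ℝ) :
    christoffel (diagForm a b) z u v =
      (deriv a z.1 / (2 * a z.1) * (u.1 * v.1) - deriv b z.1 / (2 * a z.1) * (u.2 * v.2),
        deriv b z.1 / (2 * b z.1) * (u.1 * v.2 + u.2 * v.1)) := by
  have hG := isMetricNear_diagForm ha hb ha0 hb0
  have hD (u v w : ℝ × ℝ) : fderiv ℝ (diagForm a b) z u v w =
      deriv a z.1 * u.1 * (v.1 * w.1) + deriv b z.1 * u.1 * (v.2 * w.2) := by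
    rw [← fderiv_apply_apply hG.differentiableAt]
    have a1 : HasFDerivAt (fun x : ℝ × ℝ => a x.1) _ z :=
      hasFDerivAt_comp_fst ((ha.differentiableAt (by simp)).hasDerivAt)
    have a2 : HasFDerivAt (fun x : ℝ × ℝ => b x.1) _ z :=
      hasFDerivAt_comp_fst ((hb.differentiableAt (by simp)).hasDerivAt)
    have := ((a1.mul_const (v.1 * w.1)).add (a2.mul_const (v.2 * w.2))).fderiv
    simp only [diagForm_apply]
    refine (congrArg (fun L => L u) this).trans ?_
    simp
    ring
  apply christoffel_eq hG.invertible
  intro w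
  rw [christoffelLower_apply, hD, hD, hD, diagForm_apply]
  field_simp
  ring

/-- The hypotheses on the functions `a`, `b`, `B` of the base on the set `U`: in the coordinate
`t = b(x¹)` the base metric is `dt² / (t (D t - 4 C)) + t (dx²)²`, of constant curvature `-D / 4`,
and `f = √|t| B(x²)` is a solution of `Hess f = (D / 4) f g`. -/
structure IsRoterBase (U : Set (ℝ × ℝ)) (a b B : ℝ → ℝ) (C D : ℝ) : Prop where
  isOpen : IsOpen U
  contDiffAt_b : ∀ x ∈ U, ContDiffAt ℝ ∞ b x.1
  b_ne_zero : ∀ x ∈ U, b x.1 ≠ 0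
  deriv_b_ne_zero : ∀ x ∈ U, deriv b x.1 ≠ 0
  sub_ne_zero : ∀ x ∈ U, D * b x.1 - 4 * C ≠ 0
  a_eq : ∀ x ∈ U, a x.1 = (deriv b x.1) ^ 2 / (b x.1 * (D * b x.1 - 4 * C))
  contDiffAt_B : ∀ x ∈ U, ContDiffAt ℝ ∞ B x.2
  B_ne_zero : ∀ x ∈ U, B x.2 ≠ 0
  deriv_deriv_B : ∀ x ∈ U, deriv (deriv B) x.2 / B x.2 = C

/-- The warping function `b(x¹) B(x²)²`. -/
def warping (b B : ℝ → ℝ) (z : ℝ × ℝ) : ℝ := b z.1 * B z.2 ^ 2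

/-- Half the logarithmic differential of the warping function `b(x¹) B(x²)²`. -/
def warpingLogDeriv (b B : ℝ → ℝ) (z : ℝ × ℝ) : (ℝ × ℝ) →L[ℝ] ℝ :=
  (deriv b z.1 / (2 * b z.1)) • ContinuousLinearMap.fst ℝ ℝ ℝ +
    (deriv B z.2 / B z.2) • ContinuousLinearMap.snd ℝ ℝ ℝ

/-- Half the gradient of the warping function `b(x¹) B(x²)²`. -/
def warpingGrad (b B : ℝ → ℝ) (C D : ℝ) (z : ℝ × ℝ) : ℝ × ℝ :=
  (b z.1 * (D * b z.1 - 4 * C) / (2 * deriv b z.1) * B z.2 ^ 2, B z.2 * deriv B z.2)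

@[simp] lemma warpingLogDeriv_apply (u : ℝ × ℝ) : warpingLogDeriv b B z u =
    deriv b z.1 / (2 * b z.1) * u.1 + deriv B z.2 / B z.2 * u.2 := by
  simp [warpingLogDeriv]

namespace IsRoterBase

variable {U : Set (ℝ × ℝ)} {C D : ℝ} (h : IsRoterBase U a b B C D) (hz : z ∈ U)
include h hz

lemma eventually_fst : ∀ᶠ x in 𝓝 z.1, (x, z.2) ∈ U :=
  (Continuous.continuousAt (f := fun x : ℝ => (x, z.2)) (by fun_prop)).eventually
    (h.isOpen.mem_nhds hz)

lemma a_eventuallyEq :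
    a =ᶠ[𝓝 z.1] fun x => (deriv b x) ^ 2 / (b x * (D * b x - 4 * C)) := by
  filter_upwards [h.eventually_fst hz] with x hx using h.a_eq _ hx

lemma contDiffAt_deriv_b : ContDiffAt ℝ ∞ (deriv b) z.1 :=
  contDiffAt_deriv (h.contDiffAt_b z hz)

lemma contDiffAt_a : ContDiffAt ℝ ∞ a z.1 := by
  have hb := h.contDiffAt_b z hz
  refine ContDiffAt.congr_of_eventuallyEq ?_ (h.a_eventuallyEq hz)
  exact ((h.contDiffAt_deriv_b hz).pow 2).div
    (hb.mul ((contDiffAt_const.mul hb).sub contDiffAt_const))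
    (mul_ne_zero (h.b_ne_zero z hz) (h.sub_ne_zero z hz))

lemma a_ne_zero : a z.1 ≠ 0 := by
  rw [h.a_eq z hz]
  exact div_ne_zero (pow_ne_zero 2 (h.deriv_b_ne_zero z hz))
    (mul_ne_zero (h.b_ne_zero z hz) (h.sub_ne_zero z hz))

lemma hasDerivAt_b : HasDerivAt b (deriv b z.1) z.1 :=
  ((h.contDiffAt_b z hz).differentiableAt (by simp)).hasDerivAt

lemma hasDerivAt_deriv_b : HasDerivAt (deriv b) (deriv (deriv b) z.1) z.1 :=
  ((h.contDiffAt_deriv_b hz).differentiableAt (by simp)).hasDerivAt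

lemma hasDerivAt_B : HasDerivAt B (deriv B z.2) z.2 :=
  ((h.contDiffAt_B z hz).differentiableAt (by simp)).hasDerivAt

lemma hasDerivAt_deriv_B : HasDerivAt (deriv B) (C * B z.2) z.2 := by
  have h1 := contDiffAt_deriv (h.contDiffAt_B z hz)
  have h2 : C * B z.2 = deriv (deriv B) z.2 := by
    rw [← h.deriv_deriv_B z hz, div_mul_cancel₀ _ (h.B_ne_zero z hz)]
  rw [h2]
  exact (h1.differentiableAt (by simp)).hasDerivAt

/-- The Christoffel symbol `Γ¹₁₁` in terms of `b`. -/
lemma deriv_a_div : deriv a z.1 / (2 * a z.1) = deriv (deriv b) z.1 / deriv b z.1 -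
    deriv b z.1 / (2 * b z.1) - D * deriv b z.1 / (2 * (D * b z.1 - 4 * C)) := by
  have h0 := h.b_ne_zero z hz
  have h1 := h.deriv_b_ne_zero z hz
  have h2 := h.sub_ne_zero z hz
  have h2' : b z.1 * D - 4 * C ≠ 0 := by rwa [mul_comm]
  have hb := h.hasDerivAt_b hz
  have hb1 := h.hasDerivAt_deriv_b hz
  have := (hb1.fun_pow 2).fun_div (hb.fun_mul ((hb.const_mul D).sub_const (4 * C)))
    (mul_ne_zero h0 h2)
  rw [(h.a_eventuallyEq hz).deriv_eq, this.deriv, h.a_eq z hz]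
  field_simp
  ring

/-- The Christoffel symbol `-Γ¹₂₂` in terms of `b`. -/
lemma deriv_b_div : deriv b z.1 / (2 * a z.1) =
    b z.1 * (D * b z.1 - 4 * C) / (2 * deriv b z.1) := by
  have h2 := h.sub_ne_zero z hz
  rw [h.a_eq z hz]
  field_simp

lemma isMetricNear : IsMetricNear (diagForm a b) z :=
  isMetricNear_diagForm ((h.contDiffAt_a hz).of_le two_le_infty)
    ((h.contDiffAt_b z hz).of_le two_le_infty) (h.a_ne_zero hz) (h.b_ne_zero z hz)

lemma christoffel_base (u v : ℝ × ℝ) : christoffel (diagForm a b) z u v =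
    (deriv a z.1 / (2 * a z.1) * (u.1 * v.1) -
      b z.1 * (D * b z.1 - 4 * C) / (2 * deriv b z.1) * (u.2 * v.2),
        deriv b z.1 / (2 * b z.1) * (u.1 * v.2 + u.2 * v.1)) := by
  rw [christoffel_diagForm ((h.contDiffAt_a hz).of_le two_le_infty)
    ((h.contDiffAt_b z hz).of_le two_le_infty) (h.a_ne_zero hz) (h.b_ne_zero z hz),
    h.deriv_b_div hz]

lemma hasDerivAt_christoffel_snd : HasDerivAt (fun x => deriv b x / (2 * b x))
    (deriv (deriv b) z.1 / (2 * b z.1) - (deriv b z.1) ^ 2 / (2 * b z.1 ^ 2)) z.1 := by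
  have h0 := h.b_ne_zero z hz
  have hb := h.hasDerivAt_b hz
  have hb1 := h.hasDerivAt_deriv_b hz
  refine (hb1.fun_div (hb.const_mul 2) (mul_ne_zero two_ne_zero h0)).congr_deriv ?_
  field_simp

lemma hasDerivAt_christoffel_fst :
    HasDerivAt (fun x => b x * (D * b x - 4 * C) / (2 * deriv b x))
      (D * b z.1 - 2 * C - b z.1 * (D * b z.1 - 4 * C) * deriv (deriv b) z.1 /
        (2 * (deriv b z.1) ^ 2)) z.1 := by
  have h1 := h.deriv_b_ne_zero z hz
  have hb := h.hasDerivAt_b hz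
  have hb1 := h.hasDerivAt_deriv_b hz
  refine ((hb.fun_mul ((hb.const_mul D).sub_const (4 * C))).fun_div (hb1.const_mul 2)
    (mul_ne_zero two_ne_zero h1)).congr_deriv ?_
  field_simp
  ring

lemma hasSplitCurvature : HasSplitCurvature (diagForm a b) z (-D / 4) 0 0 := by
  have hG := h.isMetricNear hz
  refine ⟨hG.invertible, hG.symm.self_of_nhds, by simp, by simp, fun X Y Z => ?_⟩
  have h0 := h.b_ne_zero z hz
  have h1 := h.deriv_b_ne_zero z hz
  have h2 := h.sub_ne_zero z hz
  have h2'' : D * b z.1 - C * 4 ≠ 0 := by rwa [mul_comm C]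
  have hc1 : DifferentiableAt ℝ (fun x => deriv a x / (2 * a x)) z.1 := by
    have e : (fun x => deriv a x / (2 * a x)) =ᶠ[𝓝 z.1] fun x => deriv (deriv b) x / deriv b x -
        deriv b x / (2 * b x) - D * deriv b x / (2 * (D * b x - 4 * C)) := by
      filter_upwards [h.eventually_fst hz] with x hx using h.deriv_a_div hx
    have d0 := (h.hasDerivAt_b hz).differentiableAt
    have d1 := (h.hasDerivAt_deriv_b hz).differentiableAt
    have d2 : DifferentiableAt ℝ (deriv (deriv b)) z.1 :=
      (contDiffAt_deriv (h.contDiffAt_deriv_b hz)).differentiableAt (by simp)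
    refine DifferentiableAt.congr_of_eventuallyEq ?_ e
    fun_prop (disch := simpa)
  have hD (u v w : ℝ × ℝ) : fderiv ℝ (christoffel (diagForm a b)) z u v w =
      (deriv (fun x => deriv a x / (2 * a x)) z.1 * u.1 * (v.1 * w.1) -
        (D * b z.1 - 2 * C - b z.1 * (D * b z.1 - 4 * C) * deriv (deriv b) z.1 /
        (2 * (deriv b z.1) ^ 2)) * u.1 * (v.2 * w.2),
      (deriv (deriv b) z.1 / (2 * b z.1) - (deriv b z.1) ^ 2 / (2 * b z.1 ^ 2)) * u.1 *
        (v.1 * w.2 + v.2 * w.1)) := by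
    rw [hG.fderiv_christoffel_apply]
    have e : (fun x => christoffel (diagForm a b) x v w) =ᶠ[𝓝 z] fun x =>
      (deriv a x.1 / (2 * a x.1) * (v.1 * w.1) -
        b x.1 * (D * b x.1 - 4 * C) / (2 * deriv b x.1) * (v.2 * w.2),
          deriv b x.1 / (2 * b x.1) * (v.1 * w.2 + v.2 * w.1)) := by
      filter_upwards [h.isOpen.mem_nhds hz] with x hx using h.christoffel_base hx v w
    rw [e.fderiv_eq]
    have a1 : HasFDerivAt (fun x : ℝ × ℝ => deriv a x.1 / (2 * a x.1)) _ z :=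
      hasFDerivAt_comp_fst (hc1.hasDerivAt)
    have a2 : HasFDerivAt
        (fun x : ℝ × ℝ => b x.1 * (D * b x.1 - 4 * C) / (2 * deriv b x.1)) _ z :=
      hasFDerivAt_comp_fst (h.hasDerivAt_christoffel_fst hz)
    have a3 : HasFDerivAt (fun x : ℝ × ℝ => deriv b x.1 / (2 * b x.1)) _ z :=
      hasFDerivAt_comp_fst (h.hasDerivAt_christoffel_snd hz)
    have := (((a1.mul_const (v.1 * w.1)).sub (a2.mul_const (v.2 * w.2))).prodMk
      (a3.mul_const (v.1 * w.2 + v.2 * w.1))).fderiv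
    refine (congrArg (fun L => L u) this).trans ?_
    ext
    · simp; ring
    · simp; ring
  rw [curvature_apply, hD, hD]
  simp only [h.christoffel_base hz, h.deriv_a_div hz, diagForm_apply]
  simp only [h.a_eq z hz]
  ext
  · simp
    field_simp
    ring
  · simp
    field_simp
    ring

lemma contDiffAt_warping : ContDiffAt ℝ ∞ (warping b B) z :=
  ((h.contDiffAt_b z hz).comp z contDiffAt_fst).mul
    (((h.contDiffAt_B z hz).comp z contDiffAt_snd).pow 2)

lemma warping_ne_zero : warping b B z ≠ 0 :=
  mul_ne_zero (h.b_ne_zero z hz) (pow_ne_zero 2 (h.B_ne_zero z hz))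

lemma hasFDerivAt_warping :
    HasFDerivAt (warping b B) ((2 * warping b B z) • warpingLogDeriv b B z) z := by
  have h0 := h.b_ne_zero z hz
  have a1 : HasFDerivAt (fun x : ℝ × ℝ => b x.1) _ z :=
      hasFDerivAt_comp_fst (h.hasDerivAt_b hz)
  have a2 : HasFDerivAt (fun x : ℝ × ℝ => B x.2) _ z :=
      hasFDerivAt_comp_snd (h.hasDerivAt_B hz)
  refine (a1.mul (a2.pow 2)).congr_fderiv ?_
  ext <;> simp [warping] <;> field_simp

lemma diagForm_warpingGrad (v : ℝ × ℝ) :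
    diagForm a b z (warpingGrad b B C D z) v = warping b B z * warpingLogDeriv b B z v := by
  have h0 := h.b_ne_zero z hz
  have h2 := h.sub_ne_zero z hz
  have h2' : b z.1 * D - 4 * C ≠ 0 := by rwa [mul_comm]
  have h3 := h.B_ne_zero z hz
  rw [diagForm_apply, warpingLogDeriv_apply, h.a_eq z hz]
  simp only [warpingGrad, warping]
  field_simp

/-- The warped product over the base of a fiber which has curvature `K` at the given point. -/
lemma hasSplitCurvature_warpForm {V : Type*} [NormedAddCommGroup V] [NormedSpace ℝ V]
    [FiniteDimensional ℝ V] {k : V → V →L[ℝ] V →L[ℝ] ℝ} {y : V} (hk : IsMetricNear k y) {K : ℝ}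
    (hK : HasSplitCurvature k y K 0 0) :
    HasSplitCurvature (warpForm (diagForm a b) (warping b B) k) (z, y) (-D / 4)
      ((K - ((deriv B z.2) ^ 2 - C * B z.2 ^ 2)) / warping b B z)
      (LinearMap.prodMap 0 LinearMap.id) := by
  have h0 := h.b_ne_zero z hz
  have h1 := h.deriv_b_ne_zero z hz
  have h2 := h.sub_ne_zero z hz
  have h2' : b z.1 * D - 4 * C ≠ 0 := by rwa [mul_comm]
  have h3 := h.B_ne_zero z hz
  have c2 : HasFDerivAt
      (fun x : ℝ × ℝ => b x.1 * (D * b x.1 - 4 * C) / (2 * deriv b x.1)) _ z :=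
    hasFDerivAt_comp_fst (h.hasDerivAt_christoffel_fst hz)
  have c3 : HasFDerivAt (fun x : ℝ × ℝ => deriv b x.1 / (2 * b x.1)) _ z :=
      hasFDerivAt_comp_fst (h.hasDerivAt_christoffel_snd hz)
  have cB : HasFDerivAt (fun x : ℝ × ℝ => B x.2) _ z :=
      hasFDerivAt_comp_snd (h.hasDerivAt_B hz)
  have cB1 : HasFDerivAt (fun x : ℝ × ℝ => deriv B x.2) _ z :=
      hasFDerivAt_comp_snd (h.hasDerivAt_deriv_B hz)
  have cBB : HasFDerivAt (fun x : ℝ × ℝ => deriv B x.2 / B x.2) _ z :=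
      hasFDerivAt_comp_snd (((h.hasDerivAt_deriv_B hz).fun_div (h.hasDerivAt_B hz) h3))
  have hU := h.isOpen.mem_nhds hz
  have key := Roter.hasSplitCurvature_warpForm (z := (z, y)) (θ := warpingLogDeriv b B)
    (N := warpingGrad b B C D) (h.isMetricNear hz) hk
    ((h.contDiffAt_warping hz).of_le two_le_infty) (h.warping_ne_zero hz)
    (by filter_upwards [hU] with x hx using h.hasFDerivAt_warping hx)
    (by filter_upwards [hU] with x hx using h.diagForm_warpingGrad hx)
    ((c3.smul_const (ContinuousLinearMap.fst ℝ ℝ ℝ)).add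
      (cBB.smul_const (ContinuousLinearMap.snd ℝ ℝ ℝ)))
    ((c2.mul (cB.pow 2)).prodMk (cB.mul cB1)) (h.hasSplitCurvature hz) hK
    (by
      intro u v
      simp only [h.christoffel_base hz, h.deriv_a_div hz, diagForm_apply]
      simp [h.a_eq z hz]
      field_simp
      ring)
    (by
      intro u
      ext
      · simp [h.christoffel_base hz, h.deriv_a_div hz, warping, warpingGrad]
        field_simp
        ring
      · simp [h.christoffel_base hz, warping, warpingGrad]
        field_simp
        ring)
  convert key using 1
  simp [warping, warpingGrad]
  field_simp
  ring

variable {p q : ℝ}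

lemma hasDerivAt_conj (hqb : 1 + q * b z.1 ≠ 0) :
    HasDerivAt (fun x => p * b x / (1 + q * b x)) (p * deriv b z.1 / (1 + q * b z.1) ^ 2) z.1 := by
  have hb := h.hasDerivAt_b hz
  refine ((hb.const_mul p).fun_div ((hb.const_mul q).const_add 1) hqb).congr_deriv ?_
  field_simp
  ring

omit hz in
/-- The conjugate base is of the same kind, with the same `C` and with `(D + 4 C q) / p` for `D`. -/
lemma conj (hp : p ≠ 0) (hqb : ∀ x ∈ U, 1 + q * b x.1 ≠ 0) :
    IsRoterBase U (fun x => p * a x / (1 + q * b x) ^ 2) (fun x => p * b x / (1 + q * b x)) B C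
      ((D + 4 * C * q) / p) where
  isOpen := h.isOpen
  contDiffAt_b x hx := (contDiffAt_const.mul (h.contDiffAt_b x hx)).div
    (contDiffAt_const.add (contDiffAt_const.mul (h.contDiffAt_b x hx))) (hqb x hx)
  b_ne_zero x hx := div_ne_zero (mul_ne_zero hp (h.b_ne_zero x hx)) (hqb x hx)
  deriv_b_ne_zero x hx := by
    rw [(h.hasDerivAt_conj hx (hqb x hx)).deriv]
    exact div_ne_zero (mul_ne_zero hp (h.deriv_b_ne_zero x hx)) (pow_ne_zero 2 (hqb x hx))
  sub_ne_zero x hx := by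
    have h2 := h.sub_ne_zero x hx
    have h3 := hqb x hx
    have : (D + 4 * C * q) / p * (p * b x.1 / (1 + q * b x.1)) - 4 * C =
        (D * b x.1 - 4 * C) / (1 + q * b x.1) := by field_simp; ring
    rw [this]
    exact div_ne_zero h2 h3
  a_eq x hx := by
    have h3 := hqb x hx
    have : (D + 4 * C * q) / p * (p * b x.1 / (1 + q * b x.1)) - 4 * C =
        (D * b x.1 - 4 * C) / (1 + q * b x.1) := by field_simp; ring
    rw [(h.hasDerivAt_conj hx h3).deriv, this, h.a_eq x hx]
    field_simp
  contDiffAt_B := h.contDiffAt_B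
  B_ne_zero := h.B_ne_zero
  deriv_deriv_B := h.deriv_deriv_B

end IsRoterBase

/-- The covector field `d (-½ log |1 + q b(x¹)|)`, the difference of the two connections of a pair of
conjugate metrics in the sense of `christoffel_conj`. -/
def conjCovector (b : ℝ → ℝ) (q : ℝ) (z : ℝ × ℝ) : (ℝ × ℝ) →L[ℝ] ℝ :=
  (-(q * deriv b z.1 / (2 * (1 + q * b z.1)))) • ContinuousLinearMap.fst ℝ ℝ ℝ

@[simp] lemma conjCovector_apply (q : ℝ) (u : ℝ × ℝ) :
    conjCovector b q z u = -(q * deriv b z.1 / (2 * (1 + q * b z.1))) * u.1 := by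
  simp [conjCovector]

namespace IsRoterBase

variable {U : Set (ℝ × ℝ)} {C D : ℝ} (h : IsRoterBase U a b B C D) (hz : z ∈ U)
  {p q : ℝ} (hp : p ≠ 0) (hqb : ∀ x ∈ U, 1 + q * b x.1 ≠ 0)
include h hz hp hqb

/-- Weyl's criterion for projective equivalence, for the two base metrics. -/
lemma christoffel_conj (u v : ℝ × ℝ) :
    christoffel (diagForm (fun x => p * a x / (1 + q * b x) ^ 2) (fun x => p * b x / (1 + q * b x)))
      z u v = christoffel (diagForm a b) z u v + conjCovector b q z u • v +
        conjCovector b q z v • u := by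
  have h' := h.conj hp hqb
  have h0 := h.b_ne_zero z hz
  have h3 := hqb z hz
  have h4 := h.a_ne_zero hz
  have ha' : HasDerivAt a (deriv a z.1) z.1 :=
    ((h.contDiffAt_a hz).differentiableAt (by simp)).hasDerivAt
  have hb := h.hasDerivAt_b hz
  have ha := (ha'.const_mul p).fun_div (((hb.const_mul q).const_add 1).fun_pow 2)
    (pow_ne_zero 2 h3)
  rw [christoffel_diagForm ((h'.contDiffAt_a hz).of_le two_le_infty)
    ((h'.contDiffAt_b z hz).of_le two_le_infty) (h'.a_ne_zero hz) (h'.b_ne_zero z hz),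
    christoffel_diagForm ((h.contDiffAt_a hz).of_le two_le_infty)
    ((h.contDiffAt_b z hz).of_le two_le_infty) h4 h0, (h.hasDerivAt_conj hz h3).deriv, ha.deriv]
  ext
  · simp
    field_simp
    ring
  · simp
    field_simp
    ring

/-- Weyl's criterion for projective equivalence, for the two warped products: the gradients of the
warping functions agree, and their half logarithmic differentials differ by the covector `ψ`. -/
lemma christoffel_warpForm_conj {V : Type*} [NormedAddCommGroup V] [NormedSpace ℝ V]
    [FiniteDimensional ℝ V] {k : V → V →L[ℝ] V →L[ℝ] ℝ} {y : V} (hk : IsMetricNear k y)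
    (u v : (ℝ × ℝ) × V) :
    christoffel (warpForm
        (diagForm (fun x => p * a x / (1 + q * b x) ^ 2) (fun x => p * b x / (1 + q * b x)))
        (warping (fun x => p * b x / (1 + q * b x)) B) k) (z, y) u v =
      christoffel (warpForm (diagForm a b) (warping b B) k) (z, y) u v +
        conjCovector b q z u.1 • v + conjCovector b q z v.1 • u := by
  have h' := h.conj hp hqb
  have h0 := h.b_ne_zero z hz
  have h3 := hqb z hz
  rw [christoffel_warpForm (z := (z, y)) (h.isMetricNear hz) hk
      ((h.contDiffAt_warping hz).of_le two_le_infty) (h.hasFDerivAt_warping hz)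
      (h.warping_ne_zero hz) (h.diagForm_warpingGrad hz),
    christoffel_warpForm (z := (z, y)) (h'.isMetricNear hz) hk
      ((h'.contDiffAt_warping hz).of_le two_le_infty) (h'.hasFDerivAt_warping hz)
      (h'.warping_ne_zero hz) (h'.diagForm_warpingGrad hz)]
  have hN : warpingGrad (fun x => p * b x / (1 + q * b x)) B C ((D + 4 * C * q) / p) z =
      warpingGrad b B C D z := by
    simp only [warpingGrad, (h.hasDerivAt_conj hz h3).deriv]
    ext
    · have h3' : 1 + b z.1 * q ≠ 0 := by rwa [mul_comm]
      simp
      field_simp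
      ring_nf
      simp
    · rfl
  have hθ (u : ℝ × ℝ) : warpingLogDeriv (fun x => p * b x / (1 + q * b x)) B z u =
      warpingLogDeriv b B z u + conjCovector b q z u := by
    simp only [warpingLogDeriv_apply, conjCovector_apply, (h.hasDerivAt_conj hz h3).deriv]
    field_simp
    ring
  rw [hN, h.christoffel_conj hz hp hqb]
  simp only [hθ]
  ext1
  · simp only [Prod.fst_add, Prod.smul_fst]; module
  · simp only [Prod.snd_add, Prod.smul_snd]; module

end IsRoterBase

end Base

/-! ### Forms on manifolds in the preferred charts -/

section Charts

variable {E : Type*} [NormedAddCommGroup E] [NormedSpace ℝ E]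
  {H : Type*} [TopologicalSpace H] {I : ModelWithCorners ℝ E H} [I.Boundaryless]
  {M : Type*} [TopologicalSpace M] [ChartedSpace H M]
  {E' : Type*} [NormedAddCommGroup E'] [NormedSpace ℝ E']
  {H' : Type*} [TopologicalSpace H'] {I' : ModelWithCorners ℝ E' H'} [I'.Boundaryless]
  {M' : Type*} [TopologicalSpace M'] [ChartedSpace H' M']

lemma extChartAt_target_mem_nhds_self (x : M) :
    (extChartAt I x).target ∈ 𝓝 (extChartAt I x x) :=
  (isOpen_extChartAt_target x).mem_nhds (mem_extChartAt_target x)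

lemma isInvertible_mfderiv_extChartAt_symm [IsManifold I ∞ M] {x : M} {w : E}
    (hw : w ∈ (extChartAt I x).target) :
    (mfderiv 𝓘(ℝ, E) I (extChartAt I x).symm w).IsInvertible := by
  have : IsManifold I 1 M := IsManifold.of_le (n := ∞) (mod_cast le_top)
  have := isInvertible_mfderivWithin_extChartAt_symm hw
  rwa [I.range_eq_univ, mfderivWithin_univ] at this

lemma mdifferentiableAt_extChartAt_symm [IsManifold I ∞ M] {x : M} {w : E}
    (hw : w ∈ (extChartAt I x).target) :
    MDifferentiableAt 𝓘(ℝ, E) I (extChartAt I x).symm w :=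
  ((contMDiffOn_extChartAt_symm (n := ∞) x).contMDiffAt
    ((isOpen_extChartAt_target x).mem_nhds hw)).mdifferentiableAt (by simp)

omit [I.Boundaryless] in
lemma inChart_apply (g : FormField I M) (x : M) (w u v : E) :
    inChart g x w u v = g ((extChartAt I x).symm w)
      (mfderiv 𝓘(ℝ, E) I (extChartAt I x).symm w u)
      (mfderiv 𝓘(ℝ, E) I (extChartAt I x).symm w v) := rfl

lemma IsSemiRiemannian.isMetricNear [FiniteDimensional ℝ E] [IsManifold I ∞ M] {g : FormField I M}
    (hg : IsSemiRiemannian g) {x : M} {w : E} (hw : w ∈ (extChartAt I x).target) :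
    IsMetricNear (inChart g x) w where
  contDiffAt := ((hg.smooth x).contDiffAt ((isOpen_extChartAt_target x).mem_nhds hw)).of_le
    two_le_infty
  symm := Eventually.of_forall fun w u v => by
    rw [inChart_apply, inChart_apply, hg.symm]
  invertible := by
    refine isInvertible_of_nondegenerate _ fun u hu => ?_
    have hi := isInvertible_mfderiv_extChartAt_symm (I := I) hw
    refine hi.injective (Eq.trans (hg.nondegenerate _ _ fun v => ?_) (map_zero _).symm)
    obtain ⟨v, rfl⟩ := hi.surjective v
    exact hu v

omit [I.Boundaryless] [I'.Boundaryless] in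
lemma warpedProduct_apply (g : FormField I M) (F : M → ℝ) (g' : FormField I' M') (z : M × M')
    (u v : E × E') :
    warpedProduct g F g' z u v = g z.1 u.1 v.1 + F z.1 * g' z.2 u.2 v.2 := by
  have h1 : mfderiv (I.prod I') I (Prod.fst : M × M' → M) z = ContinuousLinearMap.fst ℝ E E' :=
    mfderiv_fst
  have h2 : mfderiv (I.prod I') I' (Prod.snd : M × M' → M') z = ContinuousLinearMap.snd ℝ E E' :=
    mfderiv_snd
  change g z.1 (mfderiv (I.prod I') I (Prod.fst : M × M' → M) z u)
      (mfderiv (I.prod I') I (Prod.fst : M × M' → M) z v) +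
    F z.1 * g' z.2 (mfderiv (I.prod I') I' (Prod.snd : M × M' → M') z u)
      (mfderiv (I.prod I') I' (Prod.snd : M × M' → M') z v) = _
  rw [h1, h2]
  rfl

/-- In a product chart a warped product of manifolds is a warped product of coordinate domains. -/
lemma inChart_warpedProduct [IsManifold I ∞ M] [IsManifold I' ∞ M'] (g : FormField I M)
    (F : M → ℝ) (g' : FormField I' M') (x : M × M') {w : E × E'}
    (hw : w ∈ (extChartAt (I.prod I') x).target) :
    inChart (warpedProduct g F g') x w =
      warpForm (inChart g x.1) (fun s => F ((extChartAt I x.1).symm s)) (inChart g' x.2) w := by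
  have hw' : w.1 ∈ (extChartAt I x.1).target ∧ w.2 ∈ (extChartAt I' x.2).target := by
    rw [extChartAt_prod] at hw; exact hw
  have hs := mdifferentiableAt_extChartAt_symm (I := I.prod I') hw
  have h1 : (Prod.fst : M × M' → M) ∘ (extChartAt (I.prod I') x).symm =
      (extChartAt I x.1).symm ∘ Prod.fst := by
    rw [extChartAt_prod]; rfl
  have h2 : (Prod.snd : M × M' → M') ∘ (extChartAt (I.prod I') x).symm =
      (extChartAt I' x.2).symm ∘ Prod.snd := by
    rw [extChartAt_prod]; rfl
  obtain ⟨T, hT⟩ : ∃ T : E × E' →L[ℝ] E × E',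
      T = mfderiv 𝓘(ℝ, E × E') (I.prod I') (extChartAt (I.prod I') x).symm w := ⟨_, rfl⟩
  obtain ⟨T₁, hT₁⟩ : ∃ T₁ : E →L[ℝ] E,
      T₁ = mfderiv 𝓘(ℝ, E) I (extChartAt I x.1).symm w.1 := ⟨_, rfl⟩
  obtain ⟨T₂, hT₂⟩ : ∃ T₂ : E' →L[ℝ] E',
      T₂ = mfderiv 𝓘(ℝ, E') I' (extChartAt I' x.2).symm w.2 := ⟨_, rfl⟩
  have e1 (u : E × E') : (T u).1 = T₁ u.1 := by
    have a := mfderiv_comp w (I' := I.prod I') (I'' := I) (mdifferentiableAt_fst) hs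
    rw [h1] at a
    have b := mfderiv_comp w (I := 𝓘(ℝ, E × E')) (I' := 𝓘(ℝ, E)) (I'' := I) (f := Prod.fst)
      (mdifferentiableAt_extChartAt_symm (I := I) hw'.1)
      differentiableAt_fst.mdifferentiableAt
    rw [b, mfderiv_fst] at a
    have := congrArg (fun L => L u) a
    simp only [mfderiv_eq_fderiv, fderiv_fst] at this
    rw [hT, hT₁]
    exact this.symm
  have e2 (u : E × E') : (T u).2 = T₂ u.2 := by
    have a := mfderiv_comp w (I' := I.prod I') (I'' := I') (mdifferentiableAt_snd) hs
    rw [h2] at a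
    have b := mfderiv_comp w (I := 𝓘(ℝ, E × E')) (I' := 𝓘(ℝ, E')) (I'' := I') (f := Prod.snd)
      (mdifferentiableAt_extChartAt_symm (I := I') hw'.2)
      differentiableAt_snd.mdifferentiableAt
    rw [b, mfderiv_snd] at a
    have := congrArg (fun L => L u) a
    simp only [mfderiv_eq_fderiv, fderiv_snd] at this
    rw [hT, hT₂]
    exact this.symm
  refine ContinuousLinearMap.ext fun u => ContinuousLinearMap.ext fun v => ?_
  have l : inChart (warpedProduct g F g') x w u v =
      warpedProduct g F g' ((extChartAt (I.prod I') x).symm w) (T u) (T v) := by rw [hT]; rfl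
  have r₁ : inChart g x.1 w.1 u.1 v.1 = g ((extChartAt I x.1).symm w.1) (T₁ u.1) (T₁ v.1) := by
    rw [hT₁]; rfl
  have r₂ : inChart g' x.2 w.2 u.2 v.2 = g' ((extChartAt I' x.2).symm w.2) (T₂ u.2) (T₂ v.2) := by
    rw [hT₂]; rfl
  have p₁ := congrFun h1 w
  have p₂ := congrFun h2 w
  simp only [Function.comp_apply] at p₁ p₂
  rw [l, warpedProduct_apply, warpForm_apply, r₁, r₂, e1, e1, e2, e2, p₁, p₂]

lemma isSemiRiemannian_warpedProduct [IsManifold I ∞ M] [IsManifold I' ∞ M']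
    {g : FormField I M} {F : M → ℝ} {g' : FormField I' M'}
    (hg : IsSemiRiemannian g) (hg' : IsSemiRiemannian g') (hF : ∀ x, F x ≠ 0)
    (hFs : ∀ x, ContDiffOn ℝ ∞ (fun s => F ((extChartAt I x).symm s)) (extChartAt I x).target) :
    IsSemiRiemannian (warpedProduct g F g') where
  symm x := by
    have key (u v : E × E') : warpedProduct g F g' x u v = warpedProduct g F g' x v u := by
      rw [warpedProduct_apply, warpedProduct_apply]
      exact congrArg₂ (· + ·) (hg.symm _ _ _) (congrArg _ (hg'.symm _ _ _))
    exact key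
  nondegenerate x := by
    have key (u : E × E') (hu : ∀ v : E × E', warpedProduct g F g' x u v = 0) : u = 0 := by
      refine Prod.ext (hg.nondegenerate x.1 u.1 fun v => ?_)
        (hg'.nondegenerate x.2 u.2 fun v => ?_)
      · have h0 : g' x.2 u.2 (0 : E') = 0 := map_zero _
        have h1 : g x.1 u.1 v + F x.1 * g' x.2 u.2 (0 : E') = 0 :=
          (warpedProduct_apply g F g' x u (v, 0)).symm.trans (hu (v, 0))
        linear_combination h1 - F x.1 * h0
      · have h0 : g x.1 u.1 (0 : E) = 0 := map_zero _
        have h1 : g x.1 u.1 (0 : E) + F x.1 * g' x.2 u.2 v = 0 :=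
          (warpedProduct_apply g F g' x u (0, v)).symm.trans (hu (0, v))
        refine (mul_eq_zero.1 (?_ : F x.1 * g' x.2 u.2 v = 0)).resolve_left (hF _)
        linear_combination h1 - h0
    exact key
  smooth x := by
    have hc (w : E × E') (hw : w ∈ (extChartAt (I.prod I') x).target) :
        ContDiffAt ℝ ∞ (warpForm (inChart g x.1) (fun s => F ((extChartAt I x.1).symm s))
          (inChart g' x.2)) w := by
      have hw' : w.1 ∈ (extChartAt I x.1).target ∧ w.2 ∈ (extChartAt I' x.2).target := by
        rw [extChartAt_prod] at hw; exact hw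
      have n1 := (isOpen_extChartAt_target (I := I) x.1).mem_nhds hw'.1
      have n2 := (isOpen_extChartAt_target (I := I') x.2).mem_nhds hw'.2
      exact contDiffAt_warpForm ((hg.smooth x.1).contDiffAt n1) ((hFs x.1).contDiffAt n1)
        ((hg'.smooth x.2).contDiffAt n2)
    exact ContDiffOn.congr (fun w hw => (hc w hw).contDiffWithinAt)
      fun w hw => inChart_warpedProduct g F g' x hw

omit [I.Boundaryless] in
/-- Weyl's criterion: if the two connections differ by `ψ ⊗ id + id ⊗ ψ`, the identity maps
geodesics to geodesics. -/
lemma isGeodesicMapping_refl {g g' : FormField I M} (hg : IsSemiRiemannian g)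
    (hg' : IsSemiRiemannian g')
    (h : ∀ x : M, ∃ ψ : E →L[ℝ] ℝ, ∀ v, christoffel (inChart g' x) (extChartAt I x x) v v =
      christoffel (inChart g x) (extChartAt I x x) v v + ψ v • v + ψ v • v) :
    IsGeodesicMapping g g' (Diffeomorph.refl I M ∞) where
  source := hg
  target := hg'
  maps_geodesics γ s _ _ hγ := by
    choose ψ hψ using h
    refine ⟨hγ.1, fun t => 2 * ψ (γ t) (velocity I γ t), fun t ht => ?_⟩
    have h0 := hγ.2 t ht
    have e : (Diffeomorph.refl I M ∞ : M → M) ∘ γ = γ := rfl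
    rw [e]
    unfold acceleration at h0 ⊢
    rw [hψ]
    linear_combination (norm := module) h0

end Charts

/-! ### The base metric on an open set of the plane -/

section OpenBase

variable (U : TopologicalSpace.Opens (ℝ × ℝ)) {a b B : ℝ → ℝ} {C D : ℝ}

lemma val_extChartAt_symm (x : U) {w : ℝ × ℝ} (hw : w ∈ (extChartAt 𝓘(ℝ, ℝ × ℝ) x).target) :
    ((extChartAt 𝓘(ℝ, ℝ × ℝ) x).symm w : ℝ × ℝ) = w :=
  (extChartAt 𝓘(ℝ, ℝ × ℝ) x).right_inv hw

lemma mem_of_mem_extChartAt_target (x : U) {w : ℝ × ℝ}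
    (hw : w ∈ (extChartAt 𝓘(ℝ, ℝ × ℝ) x).target) : w ∈ (U : Set (ℝ × ℝ)) := by
  rw [← val_extChartAt_symm U x hw]
  exact Subtype.property _

/-- The inclusion `U → ℝ × ℝ` is the preferred chart around every point, so its derivative inverts
that of the inverse chart. -/
lemma mfderiv_val_extChartAt_symm (x : U) {w : ℝ × ℝ}
    (hw : w ∈ (extChartAt 𝓘(ℝ, ℝ × ℝ) x).target) (u : ℝ × ℝ) :
    mfderiv 𝓘(ℝ, ℝ × ℝ) 𝓘(ℝ, ℝ × ℝ) (Subtype.val : U → ℝ × ℝ)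
      ((extChartAt 𝓘(ℝ, ℝ × ℝ) x).symm w)
      (mfderiv 𝓘(ℝ, ℝ × ℝ) 𝓘(ℝ, ℝ × ℝ) (extChartAt 𝓘(ℝ, ℝ × ℝ) x).symm w u) = u := by
  have := mfderiv_extChartAt_comp_mfderivWithin_extChartAt_symm (I := 𝓘(ℝ, ℝ × ℝ)) hw
  rw [ModelWithCorners.range_eq_univ, mfderivWithin_univ] at this
  exact congrArg (fun L => L u) this

lemma isInvertible_mfderiv_val (x : U) :
    (mfderiv 𝓘(ℝ, ℝ × ℝ) 𝓘(ℝ, ℝ × ℝ) (Subtype.val : U → ℝ × ℝ) x).IsInvertible :=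
  isInvertible_mfderiv_extChartAt (I := 𝓘(ℝ, ℝ × ℝ)) (mem_extChartAt_source x)

lemma inChart_baseMetric (a b : ℝ → ℝ) (x : U) {w : ℝ × ℝ}
    (hw : w ∈ (extChartAt 𝓘(ℝ, ℝ × ℝ) x).target) :
    inChart (baseMetric U a b) x w = diagForm a b w := by
  refine ContinuousLinearMap.ext fun u => ContinuousLinearMap.ext fun v => ?_
  rw [inChart_apply, baseMetric, pullback_apply, mfderiv_val_extChartAt_symm U x hw,
    mfderiv_val_extChartAt_symm U x hw, val_extChartAt_symm U x hw]
  rfl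

variable {U}

lemma IsRoterBase.isSemiRiemannian (h : IsRoterBase U a b B C D) :
    IsSemiRiemannian (baseMetric U a b) where
  symm x u v := by
    have := (h.isMetricNear x.2).symm.self_of_nhds
    exact this _ _
  nondegenerate x u hu := by
    have hs := isInvertible_mfderiv_val U x
    refine hs.injective (Eq.trans ((h.isMetricNear x.2).invertible.injective ?_) (map_zero _).symm)
    refine Eq.trans (ContinuousLinearMap.ext fun v => ?_) (map_zero _).symm
    obtain ⟨v, rfl⟩ := hs.surjective v
    exact hu v
  smooth x := by
    refine ContDiffOn.congr (f := diagForm a b) (fun w hw => ?_)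
      fun w hw => inChart_baseMetric U a b x hw
    have hU := mem_of_mem_extChartAt_target U x hw
    exact (contDiffAt_diagForm (h.contDiffAt_a hU) (h.contDiffAt_b w hU)).contDiffWithinAt

end OpenBase

/-! ### Roter type manifolds from split curvature -/

section Split

variable {E : Type*} [NormedAddCommGroup E] [NormedSpace ℝ E] [FiniteDimensional ℝ E]

omit [FiniteDimensional ℝ E] in
lemma HasSplitCurvature.congr {G G' : E → E →L[ℝ] E →L[ℝ] ℝ} {z : E} {c l : ℝ} {π : E →ₗ[ℝ] E}
    (h : HasSplitCurvature G z c l π) (hG : G' =ᶠ[𝓝 z] G) : HasSplitCurvature G' z c l π := by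
  have e := hG.self_of_nhds
  refine ⟨e ▸ h.invertible, e ▸ h.symm, h.idem, e ▸ h.selfAdjoint, ?_⟩
  rw [curvature_congr hG, e]
  exact h.curvature_eq

variable {H : Type*} [TopologicalSpace H] {I : ModelWithCorners ℝ E H}
  {M : Type*} [TopologicalSpace M] [ChartedSpace H M] {g : FormField I M} {x : M}
  {c l : ℝ} {π : E →ₗ[ℝ] E}

/-- The Ricci tensor is `s g + t P` with `P = g(π ·, ·)` and `t ≠ 0`. Substituting
`P = (S - s g) / t` in `R = (c / 2) g ∧ g + (l / 2) P ∧ P` gives the Roter equation. -/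
lemma HasSplitCurvature.exists_roter (h : HasSplitCurvature (inChart g x) (extChartAt I x x) c l π)
    (hl : l ≠ 0) (hπ : LinearMap.trace ℝ E π ≠ 1) :
    ∃ φ μ η : ℝ, ∀ X₁ X₂ X₃ X₄ : E, riemannAt g x X₁ X₂ X₃ X₄ =
      φ / 2 * kulkarniNomizu (ricciAt g x) (ricciAt g x) X₁ X₂ X₃ X₄ +
      μ * kulkarniNomizu (metricAt g x) (ricciAt g x) X₁ X₂ X₃ X₄ +
      η / 2 * kulkarniNomizu (metricAt g x) (metricAt g x) X₁ X₂ X₃ X₄ := by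
  set s := c * ((finrank ℝ E : ℝ) - 1)
  set t := l * (LinearMap.trace ℝ E π - 1)
  have ht : t ≠ 0 := mul_ne_zero hl (sub_ne_zero.2 hπ)
  refine ⟨l / t ^ 2, -(l * s / t ^ 2), c + l * s ^ 2 / t ^ 2, fun X₁ X₂ X₃ X₄ => ?_⟩
  have hS (X Y : E) : ricciAt g x X Y = s * metricAt g x X Y + t * metricAt g x (π X) Y :=
    h.ricci_eq X Y
  have hR : riemannAt g x X₁ X₂ X₃ X₄ =
      c * (metricAt g x X₂ X₃ * metricAt g x X₁ X₄ - metricAt g x X₁ X₃ * metricAt g x X₂ X₄) +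
      l * (metricAt g x (π X₂) X₃ * metricAt g x (π X₁) X₄ -
        metricAt g x (π X₁) X₃ * metricAt g x (π X₂) X₄) := by
    simp only [riemannAt, metricAt, h.curvature_eq, map_add, map_sub, map_smul, add_apply,
      _root_.sub_apply, _root_.smul_apply, smul_eq_mul]
  rw [hR]
  simp only [kulkarniNomizu, hS]
  field_simp
  ring

/-- A split curvature operator with `l = 0` has Einstein Ricci tensor, and one with `l ≠ 0` has
neither Einstein Ricci tensor nor vanishing Weyl tensor, as is seen on an orthogonal pair of
non-null vectors in the kernel of the projection `π`. -/
lemma HasSplitCurvature.mem_setUS_inter_setUC_iff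
    (h : HasSplitCurvature (inChart g x) (extChartAt I x x) c l π) {m : ℝ}
    (hm : LinearMap.trace ℝ E π = m) (hE : (finrank ℝ E : ℝ) = m + 2) (hm2 : 2 ≤ m)
    {e f : E} (he : π e = 0) (hf : π f = 0) (hef : metricAt g x e f = 0)
    (hee : metricAt g x e e ≠ 0) (hff : metricAt g x f f ≠ 0) :
    x ∈ setUS g ∩ setUC g ↔ l ≠ 0 := by
  have hS (X Y : E) : ricciAt g x X Y = c * (m + 1) * metricAt g x X Y +
      l * (m - 1) * metricAt g x (π X) Y := by
    have := h.ricci_eq X Y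
    rw [hE, hm] at this
    refine this.trans ?_
    simp only [metricAt]
    ring
  have hκ : scalarAt g x = c * (m + 1) * (m + 2) + l * (m - 1) * m := by
    have := h.scalar_eq
    rw [hE, hm] at this
    refine this.trans ?_
    ring
  have h0 (X : E) : metricAt g x 0 X = 0 := by simp [metricAt]
  constructor
  · rintro ⟨hUS, -⟩ rfl
    refine hUS fun X Y => ?_
    rw [hS, hκ, hE]
    field_simp
    ring
  · intro hl
    refine ⟨fun hUS => ?_, fun hUC => ?_⟩
    · have h1 := hUS e e
      rw [hS, hκ, hE, he, h0, mul_zero, add_zero] at h1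
      have h2 := mul_right_cancel₀ hee h1
      have h3 : l * (m - 1) * m = 0 := by
        field_simp at h2
        linear_combination -h2
      have h4 : l * (m - 1) * m ≠ 0 :=
        mul_ne_zero (mul_ne_zero hl (by linarith)) (by linarith)
      exact h4 h3
    · have h1 := hUC e f f e
      have hO (X : E) : ricciOp (inChart g x) (extChartAt I x x) X =
          (c * (m + 1)) • X + (l * (m - 1)) • π X := by
        rw [h.ricciOp_eq, hE, hm]
        congr 2
        ring
      have hκ' : scalar (inChart g x) (extChartAt I x x) =
        c * (m + 1) * (m + 2) + l * (m - 1) * m := hκ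
      have h2 : weylAt g x e f f e =
          l * (m - 1) / (m + 1) * (metricAt g x f f * metricAt g x e e) := by
        simp only [weylAt, weyl, hO, he, hf, wedgeEnd, h.curvature_eq, hκ', hE]
        simp only [metricAt] at hef ⊢
        generalize extChartAt I x x = z at hef ⊢
        simp [hef]
        have hm0 : m ≠ 0 := by linarith
        have hm1 : m + 1 ≠ 0 := by linarith
        have hm1' : m + 2 - 1 ≠ 0 := by linarith
        field_simp
        ring
      rw [h2] at h1
      have h4 : l * (m - 1) / (m + 1) * (metricAt g x f f * metricAt g x e e) ≠ 0 :=
        mul_ne_zero (div_ne_zero (mul_ne_zero hl (by linarith)) (by linarith))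
          (mul_ne_zero hff hee)
      exact h4 h1

end Split

section Fiber

variable {V : Type*} [NormedAddCommGroup V] [NormedSpace ℝ V] [FiniteDimensional ℝ V]
  {N : Type*} [TopologicalSpace N] [ChartedSpace V N] [IsManifold 𝓘(ℝ, V) ∞ N]

/-- A semi-Riemannian manifold that is two-dimensional or of constant curvature has at each point
the curvature tensor of a space form, whose curvature is read off from the scalar curvature. -/
lemma hasSplitCurvature_of_hasConstantCurvature {gN : FormField 𝓘(ℝ, V) N}
    (hgN : IsSemiRiemannian gN) (h2 : 2 ≤ finrank ℝ V)
    (hK : 3 ≤ finrank ℝ V → HasConstantCurvature gN) (y : N) :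
    HasSplitCurvature (inChart gN y) (extChartAt 𝓘(ℝ, V) y y)
      (scalarAt gN y / (((finrank ℝ V : ℝ) - 1) * finrank ℝ V)) 0 0 := by
  have hG := hgN.isMetricNear (mem_extChartAt_target (I := 𝓘(ℝ, V)) y)
  obtain ⟨K, hKs⟩ : ∃ K, HasSplitCurvature (inChart gN y) (extChartAt 𝓘(ℝ, V) y y) K 0 0 := by
    rcases h2.eq_or_lt with h | h
    · exact hG.exists_curvature_eq_of_finrank_eq_two h.symm
    · obtain ⟨K, hK⟩ := hK h
      refine ⟨K, hG.invertible, hG.symm.self_of_nhds, by simp, by simp, fun X Y Z => ?_⟩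
      apply hG.invertible.injective
      ext W
      have := hK y X Y Z W
      simpa [riemannAt, metricAt, wedgeEnd] using this
  have h3 : scalarAt gN y = K * ((finrank ℝ V : ℝ) - 1) * finrank ℝ V := by
    have := hKs.scalar_eq
    rw [zero_mul, zero_mul, add_zero] at this
    exact this
  have h4 : (2 : ℝ) ≤ finrank ℝ V := by exact_mod_cast h2
  have h5 : (finrank ℝ V : ℝ) - 1 ≠ 0 := by linarith
  have h6 : (finrank ℝ V : ℝ) ≠ 0 := by linarith
  rwa [h3, show K * ((finrank ℝ V : ℝ) - 1) * finrank ℝ V / (((finrank ℝ V : ℝ) - 1) * finrank ℝ V)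
    = K by field_simp]

end Fiber

/-! ### Warped products over the special bases -/

namespace IsRoterBase

variable {U : TopologicalSpace.Opens (ℝ × ℝ)} {a b B : ℝ → ℝ} {C D : ℝ}
  {V : Type*} [NormedAddCommGroup V] [NormedSpace ℝ V] [FiniteDimensional ℝ V]
  {N : Type*} [TopologicalSpace N] [ChartedSpace V N] [IsManifold 𝓘(ℝ, V) ∞ N]
  {gN : FormField 𝓘(ℝ, V) N} {F : U → ℝ}
  (h : IsRoterBase U a b B C D) (hgN : IsSemiRiemannian gN)
  (hF : ∀ x : U, F x = warping b B x)
include hF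

omit [FiniteDimensional ℝ V] in
lemma inChart_warpedProduct_eventuallyEq (x : U × N) :
    inChart (warpedProduct (baseMetric U a b) F gN) x
      =ᶠ[𝓝 (extChartAt (𝓘(ℝ, ℝ × ℝ).prod 𝓘(ℝ, V)) x x)]
    warpForm (diagForm a b) (warping b B) (inChart gN x.2) := by
  filter_upwards [extChartAt_target_mem_nhds_self (I := 𝓘(ℝ, ℝ × ℝ).prod 𝓘(ℝ, V)) x] with w hw
  rw [inChart_warpedProduct _ _ _ _ hw]
  have hw' : w.1 ∈ (extChartAt 𝓘(ℝ, ℝ × ℝ) x.1).target := by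
    rw [extChartAt_prod] at hw; exact hw.1
  refine ContinuousLinearMap.ext fun u => ContinuousLinearMap.ext fun v => ?_
  rw [warpForm_apply, warpForm_apply, inChart_baseMetric U a b x.1 hw', hF,
    val_extChartAt_symm U x.1 hw']

include h hgN

omit [FiniteDimensional ℝ V] in
lemma isSemiRiemannian_warpedProduct :
    IsSemiRiemannian (warpedProduct (baseMetric U a b) F gN) := by
  refine Roter.isSemiRiemannian_warpedProduct h.isSemiRiemannian hgN (fun x => ?_) fun x => ?_
  · rw [hF]; exact h.warping_ne_zero x.2
  · refine ContDiffOn.congr (f := warping b B) (fun w hw => ?_) fun w hw => ?_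
    · exact (h.contDiffAt_warping (mem_of_mem_extChartAt_target U x hw)).contDiffWithinAt
    · rw [hF, val_extChartAt_symm U x hw]

/-- The curvature of the warped product at a point; the coefficient of the fiber part is zero exactly
where the flatness condition holds. -/
lemma hasSplitCurvature_inChart (h2 : 2 ≤ finrank ℝ V)
    (hK : 3 ≤ finrank ℝ V → HasConstantCurvature gN) (x : U × N) :
    HasSplitCurvature (inChart (warpedProduct (baseMetric U a b) F gN) x)
      (extChartAt (𝓘(ℝ, ℝ × ℝ).prod 𝓘(ℝ, V)) x x) (-D / 4)
      ((scalarAt gN x.2 / (((finrank ℝ V : ℝ) - 1) * finrank ℝ V) -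
        ((deriv B x.1.1.2) ^ 2 - C * B x.1.1.2 ^ 2)) / warping b B x.1)
      (LinearMap.prodMap 0 LinearMap.id) :=
  (h.hasSplitCurvature_warpForm x.1.2
    (hgN.isMetricNear (mem_extChartAt_target (I := 𝓘(ℝ, V)) x.2))
    (hasSplitCurvature_of_hasConstantCurvature hgN h2 hK x.2)).congr
    (inChart_warpedProduct_eventuallyEq hF x)

lemma setUS_inter_setUC (h2 : 2 ≤ finrank ℝ V)
    (hK : 3 ≤ finrank ℝ V → HasConstantCurvature gN) :
    setUS (warpedProduct (baseMetric U a b) F gN) ∩ setUC (warpedProduct (baseMetric U a b) F gN) =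
      {z | scalarAt gN z.2 / (((finrank ℝ V : ℝ) - 1) * finrank ℝ V) ≠
        (deriv B z.1.1.2) ^ 2 - C * B z.1.1.2 ^ 2} := by
  ext x
  have hm (X Y : (ℝ × ℝ) × V) : metricAt (warpedProduct (baseMetric U a b) F gN) x X Y =
      warpForm (diagForm a b) (warping b B) (inChart gN x.2)
        (x.1.1, extChartAt 𝓘(ℝ, V) x.2 x.2) X Y := by
    have := (inChart_warpedProduct_eventuallyEq (a := a) (gN := gN) hF x).self_of_nhds
    unfold metricAt
    rw [this]
    rfl
  have ha : a x.1.1.1 ≠ 0 := h.a_ne_zero x.1.2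
  have hb : b x.1.1.1 ≠ 0 := h.b_ne_zero _ x.1.2
  rw [(h.hasSplitCurvature_inChart hgN hF h2 hK x).mem_setUS_inter_setUC_iff
    (m := finrank ℝ V) trace_prodMap_zero_id (by rw [Module.finrank_prod]; simp; ring)
    (by exact_mod_cast h2) (e := ((1, 0), 0)) (f := ((0, 1), 0)) (by simp) (by simp)
    (by rw [hm]; simp) (by rw [hm]; simpa using ha) (by rw [hm]; simpa using hb)]
  simp [h.warping_ne_zero x.1.2, sub_eq_zero]

lemma isRoterType (h2 : 2 ≤ finrank ℝ V)
    (hK : 3 ≤ finrank ℝ V → HasConstantCurvature gN) :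
    IsRoterType (warpedProduct (baseMetric U a b) F gN) where
  semiRiemannian := h.isSemiRiemannian_warpedProduct hgN hF
  four_le_dim := by rw [Module.finrank_prod]; simp; omega
  roter := by
    have key : ∀ x ∈ setUS (warpedProduct (baseMetric U a b) F gN) ∩
        setUC (warpedProduct (baseMetric U a b) F gN), ∃ φ μ η : ℝ, ∀ X₁ X₂ X₃ X₄ : (ℝ × ℝ) × V,
      riemannAt (warpedProduct (baseMetric U a b) F gN) x X₁ X₂ X₃ X₄ =
      φ / 2 * kulkarniNomizu (ricciAt (warpedProduct (baseMetric U a b) F gN) x)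
        (ricciAt (warpedProduct (baseMetric U a b) F gN) x) X₁ X₂ X₃ X₄ +
      μ * kulkarniNomizu (metricAt (warpedProduct (baseMetric U a b) F gN) x)
        (ricciAt (warpedProduct (baseMetric U a b) F gN) x) X₁ X₂ X₃ X₄ +
      η / 2 * kulkarniNomizu (metricAt (warpedProduct (baseMetric U a b) F gN) x)
        (metricAt (warpedProduct (baseMetric U a b) F gN) x) X₁ X₂ X₃ X₄ := by
      intro x hx
      rw [h.setUS_inter_setUC hgN hF h2 hK] at hx
      refine (h.hasSplitCurvature_inChart hgN hF h2 hK x).exists_roter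
        (div_ne_zero (_root_.sub_ne_zero.2 hx) (h.warping_ne_zero x.1.2)) ?_
      rw [trace_prodMap_zero_id]
      norm_cast
      omega
    choose! φ μ η hR using key
    exact ⟨φ, μ, η, hR⟩

end IsRoterBase

/-! ### The geodesic mappings -/

section Mappings

variable {U : TopologicalSpace.Opens (ℝ × ℝ)} {a b B : ℝ → ℝ} {C D p q : ℝ}
  {V : Type*} [NormedAddCommGroup V] [NormedSpace ℝ V] [FiniteDimensional ℝ V]
  {N : Type*} [TopologicalSpace N] [ChartedSpace V N] [IsManifold 𝓘(ℝ, V) ∞ N]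
  {gN : FormField 𝓘(ℝ, V) N} {F F' : U → ℝ}

lemma hasMFDerivAt_val (x : U) : HasMFDerivAt 𝓘(ℝ, ℝ × ℝ) 𝓘(ℝ, ℝ × ℝ)
    (Subtype.val : U → ℝ × ℝ) x (ContinuousLinearMap.id ℝ (ℝ × ℝ)) := by
  refine ⟨continuous_subtype_val.continuousAt, ?_⟩
  have h1 : writtenInExtChartAt 𝓘(ℝ, ℝ × ℝ) 𝓘(ℝ, ℝ × ℝ) x (Subtype.val : U → ℝ × ℝ)
      =ᶠ[𝓝 (extChartAt 𝓘(ℝ, ℝ × ℝ) x x)] id := by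
    filter_upwards [extChartAt_target_mem_nhds_self (I := 𝓘(ℝ, ℝ × ℝ)) x] with w hw
    exact val_extChartAt_symm U x hw
  exact ((hasFDerivAt_id _).congr_of_eventuallyEq h1).hasFDerivWithinAt

lemma baseMetric_apply (a b : ℝ → ℝ) (x : U) (u v : ℝ × ℝ) :
    baseMetric U a b x u v = diagForm a b x u v := by
  have : baseMetric U a b x u v = planeForm a b x
      (mfderiv 𝓘(ℝ, ℝ × ℝ) 𝓘(ℝ, ℝ × ℝ) (Subtype.val : U → ℝ × ℝ) x u)
      (mfderiv 𝓘(ℝ, ℝ × ℝ) 𝓘(ℝ, ℝ × ℝ) (Subtype.val : U → ℝ × ℝ) x v) := rfl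
  rw [this, (hasMFDerivAt_val x).mfderiv]
  rfl

lemma IsRoterBase.isGeodesicMapping_base (h : IsRoterBase U a b B C D) (hp : p ≠ 0)
    (hqb : ∀ x ∈ (U : Set (ℝ × ℝ)), 1 + q * b x.1 ≠ 0) :
    IsGeodesicMapping (baseMetric U a b)
      (baseMetric U (fun x => p * a x / (1 + q * b x) ^ 2) (fun x => p * b x / (1 + q * b x)))
      (Diffeomorph.refl 𝓘(ℝ, ℝ × ℝ) U ∞) := by
  refine isGeodesicMapping_refl h.isSemiRiemannian (h.conj hp hqb).isSemiRiemannian fun x => ?_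
  refine ⟨conjCovector b q x, fun v => ?_⟩
  have e (a b : ℝ → ℝ) : inChart (baseMetric U a b) x =ᶠ[𝓝 (extChartAt 𝓘(ℝ, ℝ × ℝ) x x)]
      diagForm a b := by
    filter_upwards [extChartAt_target_mem_nhds_self (I := 𝓘(ℝ, ℝ × ℝ)) x] with w hw
    exact inChart_baseMetric U a b x hw
  rw [(christoffel_eventuallyEq (e _ _)).self_of_nhds,
    (christoffel_eventuallyEq (e _ _)).self_of_nhds]
  exact h.christoffel_conj x.2 hp hqb v v

lemma IsRoterBase.isGeodesicMapping_warpedProduct (h : IsRoterBase U a b B C D)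
    (hgN : IsSemiRiemannian gN) (hF : ∀ x : U, F x = warping b B x)
    (hF' : ∀ x : U, F' x = warping (fun x => p * b x / (1 + q * b x)) B x) (hp : p ≠ 0)
    (hqb : ∀ x ∈ (U : Set (ℝ × ℝ)), 1 + q * b x.1 ≠ 0) :
    IsGeodesicMapping (warpedProduct (baseMetric U a b) F gN)
      (warpedProduct (baseMetric U (fun x => p * a x / (1 + q * b x) ^ 2)
        (fun x => p * b x / (1 + q * b x))) F' gN)
      (Diffeomorph.refl (𝓘(ℝ, ℝ × ℝ).prod 𝓘(ℝ, V)) (U × N) ∞) := by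
  refine isGeodesicMapping_refl (h.isSemiRiemannian_warpedProduct hgN hF)
    ((h.conj hp hqb).isSemiRiemannian_warpedProduct hgN hF') fun x => ?_
  refine ⟨conjCovector b q x.1 ∘L ContinuousLinearMap.fst ℝ _ _, fun v => ?_⟩
  rw [(christoffel_eventuallyEq
      (IsRoterBase.inChart_warpedProduct_eventuallyEq hF' x)).self_of_nhds,
    (christoffel_eventuallyEq
      (IsRoterBase.inChart_warpedProduct_eventuallyEq hF x)).self_of_nhds]
  exact h.christoffel_warpForm_conj x.1.2 hp hqb
    (hgN.isMetricNear (mem_extChartAt_target (I := 𝓘(ℝ, V)) x.2)) v v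

/-- In common coordinates the second metric arises from the first by the factor `p / (1 + q b)²` in
the direction of `x¹` and by `p / (1 + q b)` in the remaining `n - 1` directions. -/
lemma IsRoterBase.detRatio_eq (h : IsRoterBase U a b B C D)
    (hgN : IsSemiRiemannian gN) (hF : ∀ x : U, F x = warping b B x)
    (hF' : ∀ x : U, F' x = warping (fun x => p * b x / (1 + q * b x)) B x)
    (x : U × N) :
    detRatio (warpedProduct (baseMetric U a b) F gN)
      (warpedProduct (baseMetric U (fun x => p * a x / (1 + q * b x) ^ 2)
        (fun x => p * b x / (1 + q * b x))) F' gN)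
      (Diffeomorph.refl (𝓘(ℝ, ℝ × ℝ).prod 𝓘(ℝ, V)) (U × N) ∞) x =
    p / (1 + q * b x.1.1.1) ^ 2 * (p / (1 + q * b x.1.1.1)) *
      (p / (1 + q * b x.1.1.1)) ^ finrank ℝ V := by
  set α := p / (1 + q * b x.1.1.1) ^ 2 with hα
  set β := p / (1 + q * b x.1.1.1) with hβ
  let A : ((ℝ × ℝ) × V) →ₗ[ℝ] (ℝ × ℝ) × V :=
    LinearMap.prodMap (LinearMap.prodMap (α • LinearMap.id) (β • LinearMap.id))
      (β • LinearMap.id)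
  have hA : LinearMap.det A = α * β * β ^ finrank ℝ V := by
    simp only [A, LinearMap.det_prodMap, LinearMap.det_smul, LinearMap.det_id]
    simp
  obtain ⟨G, hG⟩ : ∃ G : ((ℝ × ℝ) × V) →L[ℝ] ((ℝ × ℝ) × V) →L[ℝ] ℝ,
    G = warpedProduct (baseMetric U a b) F gN x := ⟨_, rfl⟩
  obtain ⟨G', hG'⟩ : ∃ G' : ((ℝ × ℝ) × V) →L[ℝ] ((ℝ × ℝ) × V) →L[ℝ] ℝ,
    G' = pullback (𝓘(ℝ, ℝ × ℝ).prod 𝓘(ℝ, V))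
      (Diffeomorph.refl (𝓘(ℝ, ℝ × ℝ).prod 𝓘(ℝ, V)) (U × N) ∞)
      (warpedProduct (baseMetric U (fun x => p * a x / (1 + q * b x) ^ 2)
        (fun x => p * b x / (1 + q * b x))) F' gN) x := ⟨_, rfl⟩
  have hinv : G.IsInvertible := by
    refine isInvertible_of_nondegenerate G fun u hu => ?_
    rw [hG] at hu
    exact (h.isSemiRiemannian_warpedProduct hgN hF).nondegenerate x u hu
  have e1 (u v : (ℝ × ℝ) × V) : G u v =
      diagForm a b x.1 u.1 v.1 + warping b B x.1 * gN x.2 u.2 v.2 := by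
    rw [hG]
    refine (warpedProduct_apply _ F gN x u v).trans ?_
    rw [baseMetric_apply, hF]
  have e2 (u v : (ℝ × ℝ) × V) : G' u v =
      diagForm (fun x => p * a x / (1 + q * b x) ^ 2) (fun x => p * b x / (1 + q * b x))
        x.1 u.1 v.1 + warping (fun x => p * b x / (1 + q * b x)) B x.1 * gN x.2 u.2 v.2 := by
    rw [← hF', ← baseMetric_apply, ← warpedProduct_apply, hG']
    have hid : mfderiv (𝓘(ℝ, ℝ × ℝ).prod 𝓘(ℝ, V)) (𝓘(ℝ, ℝ × ℝ).prod 𝓘(ℝ, V))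
      (Diffeomorph.refl (𝓘(ℝ, ℝ × ℝ).prod 𝓘(ℝ, V)) (U × N) ∞) x =
      ContinuousLinearMap.id ℝ _ := mfderiv_id
    rw [pullback, hid]
    rfl
  have key : (G.inverse ∘L G').toLinearMap = A := by
    refine LinearMap.ext fun u => ?_
    change G.inverse (G' u) = A u
    rw [hinv.inverse_apply_eq]
    refine ContinuousLinearMap.ext fun v => ?_
    have hs : gN x.2 (β • u.2) v.2 = β * gN x.2 u.2 v.2 := by
      have := congrArg (fun L => L v.2) (map_smul (gN x.2) β u.2)
      exact this
    rw [e1, e2, show (A u).2 = β • u.2 from rfl, hs]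
    simp [A, warping, hα, hβ]
    ring
  rw [← hA, ← key, hG, hG']
  rfl

/-- Up to an additive constant, the potential of `ψ` is `-½ log |1 + q b(x¹)|`. -/
lemma IsRoterBase.isNontrivialMapping_warpedProduct (h : IsRoterBase U a b B C D)
    (hgN : IsSemiRiemannian gN) (hF : ∀ x : U, F x = warping b B x)
    (hF' : ∀ x : U, F' x = warping (fun x => p * b x / (1 + q * b x)) B x) (hp : p ≠ 0)
    (hq : q ≠ 0) (hqb : ∀ x ∈ (U : Set (ℝ × ℝ)), 1 + q * b x.1 ≠ 0) :
    IsNontrivialMapping (warpedProduct (baseMetric U a b) F gN)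
      (warpedProduct (baseMetric U (fun x => p * a x / (1 + q * b x) ^ 2)
        (fun x => p * b x / (1 + q * b x))) F' gN)
      (Diffeomorph.refl (𝓘(ℝ, ℝ × ℝ).prod 𝓘(ℝ, V)) (U × N) ∞) := by
  intro x
  set m := finrank ℝ V
  have hdim : (finrank ℝ ((ℝ × ℝ) × V) : ℝ) = m + 2 := by
    rw [Module.finrank_prod]; simp [m]; ring
  let pot : ℝ × ℝ → ℝ := fun w => (m + 2) / (2 * (m + 3)) * Real.log p -
    2⁻¹ * Real.log (1 + q * b w.1)
  have hpot : (fun y : U × N => 1 / (2 * ((finrank ℝ ((ℝ × ℝ) × V) : ℝ) + 1)) * Real.log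
      |detRatio (warpedProduct (baseMetric U a b) F gN)
      (warpedProduct (baseMetric U (fun x => p * a x / (1 + q * b x) ^ 2)
        (fun x => p * b x / (1 + q * b x))) F' gN)
      (Diffeomorph.refl (𝓘(ℝ, ℝ × ℝ).prod 𝓘(ℝ, V)) (U × N) ∞) y|) =
      pot ∘ (Subtype.val : U → ℝ × ℝ) ∘ Prod.fst := by
    funext y
    have h3 := hqb y.1.1 y.1.2
    have h4 : (m : ℝ) + 3 ≠ 0 := by positivity
    have h5 : p / (1 + q * b y.1.1.1) ≠ 0 := div_ne_zero hp h3
    have h6 : p / (1 + q * b y.1.1.1) ^ 2 ≠ 0 := div_ne_zero hp (pow_ne_zero 2 h3)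
    rw [h.detRatio_eq hgN hF hF', Real.log_abs, Real.log_mul (mul_ne_zero h6 h5)
      (pow_ne_zero _ h5), Real.log_mul h6 h5, Real.log_pow, Real.log_div hp h3,
      Real.log_div hp (pow_ne_zero 2 h3), Real.log_pow, hdim]
    simp only [pot, Function.comp_apply]
    have h7 : (m : ℝ) + 2 + 1 = m + 3 := by ring
    rw [h7]
    push_cast
    field_simp
    ring
  have hdpot : HasFDerivAt pot (conjCovector b q x.1.1) x.1.1 := by
    have h3 := hqb x.1.1 x.1.2
    have := hasFDerivAt_comp_fst (((((h.hasDerivAt_b x.1.2).const_mul q).const_add 1).log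
      h3).const_mul 2⁻¹)
    refine (this.const_sub _).congr_fderiv ?_
    ext <;> simp
    field_simp
  have hM := (hdpot.hasMFDerivAt.comp x.1 (hasMFDerivAt_val x.1)).comp x
    (hasMFDerivAt_fst (I := 𝓘(ℝ, ℝ × ℝ)) (I' := 𝓘(ℝ, V)) x)
  unfold projectiveCovector
  rw [hpot]
  intro h0
  have h1 := congrArg (fun L : ((ℝ × ℝ) × V) →L[ℝ] ℝ => L ((1, 0), 0)) (hM.mfderiv.symm.trans h0)
  have h2 : conjCovector b q x.1.1 (1, 0) = 0 := h1
  rw [conjCovector_apply, mul_one, neg_eq_zero, div_eq_zero_iff] at h2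
  rcases h2 with h2 | h2
  · exact mul_ne_zero hq (h.deriv_b_ne_zero _ x.1.2) h2
  · exact mul_ne_zero two_ne_zero (hqb _ x.1.2) h2

end Mappings

end Roter

end

theorem theorem4p1
    -- the coordinate domain of the base, with coordinates `(x¹, x²)`
    (U : TopologicalSpace.Opens (ℝ × ℝ))
    -- the fiber, of dimension `n - 2`, of constant curvature when `n ≥ 5`
    (n : ℕ) (hn : 4 ≤ n)
    {V : Type*} [NormedAddCommGroup V] [NormedSpace ℝ V] [FiniteDimensional ℝ V]
    (hV : Module.finrank ℝ V + 2 = n)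
    {N : Type*} [TopologicalSpace N] [ChartedSpace V N] [IsManifold 𝓘(ℝ, V) ∞ N]
    (gN : Roter.FormField 𝓘(ℝ, V) N) (hgN : Roter.IsSemiRiemannian gN)
    (hK : 5 ≤ n → Roter.HasConstantCurvature gN)
    -- the functions and constants
    (a b B : ℝ → ℝ) (C D p q : ℝ)
    (hb : ∀ x ∈ U, ContDiffAt ℝ ∞ b x.1) (hb0 : ∀ x ∈ U, b x.1 ≠ 0)
    (hb' : ∀ x ∈ U, deriv b x.1 ≠ 0) (hD : ∀ x ∈ U, D * b x.1 - 4 * C ≠ 0)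
    (ha : ∀ x ∈ U, a x.1 = (deriv b x.1) ^ 2 / (b x.1 * (D * b x.1 - 4 * C)))
    (hB : ∀ x ∈ U, ContDiffAt ℝ ∞ B x.2) (hB0 : ∀ x ∈ U, B x.2 ≠ 0)
    (hBC : ∀ x ∈ U, deriv (deriv B) x.2 / B x.2 = C)
    (hp : p ≠ 0) (hq : q ≠ 0) (hqb : ∀ x ∈ U, 1 + q * b x.1 ≠ 0)
    (F Fbar : U → ℝ) (hF : ∀ x : U, F x = b x.1.1 * B x.1.2 ^ 2)
    (hFbar : ∀ x : U, Fbar x = p / (1 + q * b x.1.1) * F x)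
    (gHat gHatBar : Roter.FormField 𝓘(ℝ, ℝ × ℝ) U)
    (hgHat : gHat = Roter.baseMetric U a b)
    (hgHatBar : gHatBar = Roter.baseMetric U
      (fun x => p * a x / (1 + q * b x) ^ 2) (fun x => p * b x / (1 + q * b x)))
    -- the conformal flatness condition does not hold identically
    (hflat : ¬ ∀ z : U × N, Roter.scalarAt gN z.2 / (((n : ℝ) - 3) * ((n : ℝ) - 2)) =
      (deriv B z.1.1.2) ^ 2 - C * B z.1.1.2 ^ 2) :
    -- the warped product is of Roter type
    Roter.IsRoterType (Roter.warpedProduct gHat F gN) ∧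
    Roter.setUS (Roter.warpedProduct gHat F gN) ∩ Roter.setUC (Roter.warpedProduct gHat F gN) =
      {z | Roter.scalarAt gN z.2 / (((n : ℝ) - 3) * ((n : ℝ) - 2)) ≠
        (deriv B z.1.1.2) ^ 2 - C * B z.1.1.2 ^ 2} ∧
    -- the bases are geodesically related
    (∃ h : U ≃ₘ^∞⟮𝓘(ℝ, ℝ × ℝ), 𝓘(ℝ, ℝ × ℝ)⟯ U, Roter.IsGeodesicMapping gHat gHatBar h) ∧
    -- the warped product admits a non-trivial geodesic mapping onto the second one
    (∃ h : (U × N) ≃ₘ^∞⟮𝓘(ℝ, ℝ × ℝ).prod 𝓘(ℝ, V), 𝓘(ℝ, ℝ × ℝ).prod 𝓘(ℝ, V)⟯ (U × N),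
      Roter.IsGeodesicMapping (Roter.warpedProduct gHat F gN)
        (Roter.warpedProduct gHatBar Fbar gN) h ∧
      Roter.IsNontrivialMapping (Roter.warpedProduct gHat F gN)
        (Roter.warpedProduct gHatBar Fbar gN) h) ∧
    -- the second warped product is of Roter type
    Roter.IsRoterType (Roter.warpedProduct gHatBar Fbar gN) ∧
    Roter.setUS (Roter.warpedProduct gHatBar Fbar gN) ∩
        Roter.setUC (Roter.warpedProduct gHatBar Fbar gN) =
      {z | Roter.scalarAt gN z.2 / (((n : ℝ) - 3) * ((n : ℝ) - 2)) ≠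
        (deriv B z.1.1.2) ^ 2 - C * B z.1.1.2 ^ 2} := by
  subst hgHat hgHatBar
  have h : Roter.IsRoterBase U a b B C D :=
    ⟨U.isOpen, hb, hb0, hb', hD, ha, hB, hB0, hBC⟩
  have h' := h.conj hp hqb
  have hF₁ : ∀ x : U, F x = Roter.warping b B x := hF
  have hF₂ : ∀ x : U, Fbar x = Roter.warping (fun x => p * b x / (1 + q * b x)) B x := fun x => by
    rw [hFbar, hF, Roter.warping]
    ring
  have h2 : 2 ≤ finrank ℝ V := by omega
  have h3 : 3 ≤ finrank ℝ V → Roter.HasConstantCurvature gN := fun h => hK (by omega)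
  have hn' : (n : ℝ) = finrank ℝ V + 2 := by rw [← hV]; push_cast; rfl
  rw [show (n : ℝ) - 3 = finrank ℝ V - 1 by rw [hn']; ring,
    show (n : ℝ) - 2 = finrank ℝ V by rw [hn']; ring]
  exact ⟨h.isRoterType hgN hF₁ h2 h3, h.setUS_inter_setUC hgN hF₁ h2 h3,
    ⟨_, h.isGeodesicMapping_base hp hqb⟩,
    ⟨_, h.isGeodesicMapping_warpedProduct hgN hF₁ hF₂ hp hqb,
      h.isNontrivialMapping_warpedProduct hgN hF₁ hF₂ hp hq hqb⟩,
    h'.isRoterType hgN hF₂ h2 h3, h'.setUS_inter_setUC hgN hF₂ h2 h3⟩
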